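/- Let $\alpha\ge 0$ be an integer and let $\nu\in\mathbb C$. Denote by $S_m$ the symmetric group on $m$ letters and by $(ij)$ a transposition. Let $\mathbb O[\alpha;\nu]$ be the associative algebra over $\mathbb C$ with generators $A(g)$ ($g\in S_\alpha$) and $\Theta_1,\dots,\Theta_\alpha$ and the relations (for all $g,g_1,g_2\in S_\alpha$ and all $i\ne j$ in $\{1,\dots,\alpha\}$) $$A(g_1)A(g_2)=A(g_1g_2),\qquad A(g)\,\Theta_i\,A(g^{-1})=\Theta_{g(i)},\qquad \Theta_j^2=(\nu-1)\Theta_j+\nu A(1),$$ $$\Theta_j\Theta_i-\Theta_i\Theta_j=A((ij))\,(\Theta_j-\Theta_i),\qquad \bigl(A((ij))-A(1)\bigr)\,\Theta_j\,\bigl(\Theta_i+A(1)\bigr)=0,$$ where $A(1)$ is the unit of the algebra. Let $\Pi_\alpha$ be the set of partial bijections of $\{1,\dots,\alpha\}$, i.e. of $\alpha\times\alpha$ matrices with entries $0$ and $1$ that have at most one entry $1$ in each row and in each column. For an integer $n\ge 0$ let $S_{\alpha+n}$ be the group of permutations of $\{1,\dots,\alpha+n\}$ and let $S_n\subset S_{\alpha+n}$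 be the subgroup of permutations that fix $1,\dots,\alpha$. Let $\mathbb C[S_n\backslash S_{\alpha+n}/S_n]$ be the subalgebra of the group algebra $\mathbb C[S_{\alpha+n}]$ that consists of the functions which are constant on the double cosets $S_n h S_n$ (its unit is $\frac1{n!}\sum_{\sigma\in S_n}\delta_\sigma$). For $g\in S_\alpha$ and $1\le i\le\alpha$ put $$a(g)=\frac1{n!}\sum_{\sigma\in S_n}\delta_{g\times\sigma},\qquad \theta_i=\frac1{n!}\sum_{h\in S_n\,(i\;\alpha+1)\,S_n}\delta_h ,$$ with $\theta_i=0$ if $n=0$. (a) For every $\nu\in\mathbb C$, $\dim\mathbb O[\alpha;\nu]=\#\Pi_\alpha$. (b) For every integer $n\ge0$ there is a unique algebra homomorphism $\mathbb O[\alpha;n]\to\mathbb C[S_n\backslash S_{\alpha+n}/S_n]$ with $A(g)\mapsto a(g)$ for all $g\in S_\alpha$ and $\Theta_i\mapsto\theta_i$ for all $i$ (in particular, these elements are biinvariant). (c) This homomorphism is an isomorphism if $n\ge\alpha$, and it is surjective if $0\le n<\alpha$. (d) There is a finite set $E\subset\mathbb C$ such that the algebras $\mathbb O[\alpha;\nu]$,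 $\nu\in\mathbb C\setminus E$, are mutually isomorphic and each of them is isomorphic to a finite direct sum of matrix algebras over $\mathbb C$. -/

import Mathlib

noncomputable section

namespace DoubleCosetAlgebra

/-- Index set of the generators of `O[α;ν]`: the symbols `A(g)`, where `g` ranges over the
symmetric group on `α` letters, and the symbols `Θ_i`, where `i` ranges over the `α` letters. -/
inductive Gen (α : ℕ) : Type
  | A (g : Equiv.Perm (Fin α)) : Gen α
  | Θ (i : Fin α) : Gen α

/-- The generator `A(g)` in the free unital associative algebra. -/
def freeA {α : ℕ} (g : Equiv.Perm (Fin α)) : FreeAlgebra ℂ (Gen α) :=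
  FreeAlgebra.ι ℂ (Gen.A g)

/-- The generator `Θ_i` in the free unital associative algebra. -/
def freeΘ {α : ℕ} (i : Fin α) : FreeAlgebra ℂ (Gen α) :=
  FreeAlgebra.ι ℂ (Gen.Θ i)

/-- The defining relations of `O[α;ν]`. The relation `one` says that `A(1)` is the unit of the
algebra; the relations `A(g₁)A(g₂) = A(g₁g₂)` and `A(g)Θ_iA(g⁻¹) = Θ_{g(i)}` alone make `A(1)` act
as the unit on all generators, so this is only the identification of `A(1)` with the unit of the
free unital algebra. -/
inductive Rel (α : ℕ) (ν : ℂ) : FreeAlgebra ℂ (Gen α) → FreeAlgebra ℂ (Gen α) → Prop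
  | one : Rel α ν (freeA 1) 1
  | mul (g₁ g₂ : Equiv.Perm (Fin α)) : Rel α ν (freeA g₁ * freeA g₂) (freeA (g₁ * g₂))
  | conj (g : Equiv.Perm (Fin α)) (i : Fin α) :
      Rel α ν (freeA g * freeΘ i * freeA g⁻¹) (freeΘ (g i))
  | sq (j : Fin α) :
      Rel α ν (freeΘ j * freeΘ j) ((ν - 1) • freeΘ j + ν • freeA 1)
  | comm (i j : Fin α) (hij : i ≠ j) :
      Rel α ν (freeΘ j * freeΘ i - freeΘ i * freeΘ j)
        (freeA (Equiv.swap i j) * (freeΘ j - freeΘ i))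
  | swap (i j : Fin α) (hij : i ≠ j) :
      Rel α ν ((freeA (Equiv.swap i j) - freeA 1) * freeΘ j * (freeΘ i + freeA 1)) 0

/-- The algebra `O[α;ν]` given by generators and relations. -/
abbrev O (α : ℕ) (ν : ℂ) : Type := RingQuot (Rel α ν)

/-- The generator `A(g)` of `O[α;ν]`. -/
def A {α : ℕ} {ν : ℂ} (g : Equiv.Perm (Fin α)) : O α ν :=
  RingQuot.mkAlgHom ℂ (Rel α ν) (freeA g)

/-- The generator `Θ_i` of `O[α;ν]`. -/
def Θ {α : ℕ} {ν : ℂ} (i : Fin α) : O α ν :=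
  RingQuot.mkAlgHom ℂ (Rel α ν) (freeΘ i)

/-- The set `Π_α` of partial bijections of `α` letters, as the `0-1` matrices of order `α` with at
most one unit in each row and at most one unit in each column. -/
def partialBijections (α : ℕ) : Set (Matrix (Fin α) (Fin α) ℂ) :=
  {M | (∀ i j, M i j = 0 ∨ M i j = 1) ∧
    (∀ i j j', M i j = 1 → M i j' = 1 → j = j') ∧
    (∀ i i' j, M i j = 1 → M i' j = 1 → i = i')}

section Biinvariant

variable {G : Type*} [Group G]

theorem coeff_biinvariant_iff (K : Subgroup G) (f : MonoidAlgebra ℂ G) :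
    (∀ k₁ ∈ K, ∀ k₂ ∈ K, ∀ g : G, f.coeff (k₁ * g * k₂) = f.coeff g) ↔
      (∀ k ∈ K, MonoidAlgebra.single k (1 : ℂ) * f = f) ∧
      (∀ k ∈ K, f * MonoidAlgebra.single k (1 : ℂ) = f) := by
  constructor
  · intro h
    refine ⟨fun k hk => ?_, fun k hk => ?_⟩
    · ext g
      simpa using h k⁻¹ (K.inv_mem hk) 1 K.one_mem g
    · ext g
      simpa using h 1 K.one_mem k⁻¹ (K.inv_mem hk) g
  · rintro ⟨h₁, h₂⟩ k₁ hk₁ k₂ hk₂ g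
    have e₁ := congrArg (fun x => x.coeff (g * k₂)) (h₁ k₁⁻¹ (K.inv_mem hk₁))
    have e₂ := congrArg (fun x => x.coeff g) (h₂ k₂⁻¹ (K.inv_mem hk₂))
    simp at e₁ e₂
    rw [mul_assoc, e₁, e₂]

/-- The algebra `ℂ[K\G/K]` of `K`-biinvariant functions: the subalgebra of the group algebra `ℂ[G]`
(with the convolution product) that consists of the functions which are constant on double cosets
`KgK`. It is a non-unital subalgebra because its unit is the uniform probability measure on `K`
rather than the unit of `ℂ[G]`. -/
def biinvariant (K : Subgroup G) : NonUnitalSubalgebra ℂ (MonoidAlgebra ℂ G) where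
  carrier := {f | ∀ k₁ ∈ K, ∀ k₂ ∈ K, ∀ g : G, f.coeff (k₁ * g * k₂) = f.coeff g}
  zero_mem' := by
    intro k₁ _ k₂ _ g
    simp
  add_mem' := by
    intro x y hx hy k₁ h₁ k₂ h₂ g
    simp [hx k₁ h₁ k₂ h₂ g, hy k₁ h₁ k₂ h₂ g]
  smul_mem' := by
    intro c x hx k₁ h₁ k₂ h₂ g
    simp [hx k₁ h₁ k₂ h₂ g]
  mul_mem' := by
    intro x y hx hy
    have hx' := (coeff_biinvariant_iff K x).1 hx
    have hy' := (coeff_biinvariant_iff K y).1 hy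
    refine (coeff_biinvariant_iff K (x * y)).2 ⟨fun k hk => ?_, fun k hk => ?_⟩
    · rw [← mul_assoc, hx'.1 k hk]
    · rw [mul_assoc, hy'.2 k hk]

end Biinvariant

/-- The symmetric group `S_{α+n}`; the summand `Fin α` is `{1, …, α}` and the summand `Fin n` is
`{α+1, …, α+n}`. -/
abbrev S (α n : ℕ) : Type := Equiv.Perm (Fin α ⊕ Fin n)

/-- The subgroup `S_n` of `S_{α+n}`: the permutations of `{α+1, …, α+n}`. -/
def K (α n : ℕ) : Subgroup (S α n) :=
  ((Equiv.Perm.sumCongrHom (Fin α) (Fin n)).comp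
    (MonoidHom.inr (Equiv.Perm (Fin α)) (Equiv.Perm (Fin n)))).range

/-- The algebra `ℂ[S_n\S_{α+n}/S_n]`. -/
abbrev DC (α n : ℕ) : Type := biinvariant (K α n)

/-- `a(g) = (1/n!) ∑_{σ ∈ S_n} δ_{g × σ}`. -/
def a {α n : ℕ} (g : Equiv.Perm (Fin α)) : MonoidAlgebra ℂ (S α n) :=
  ((n.factorial : ℂ)⁻¹) •
    ∑ σ : Equiv.Perm (Fin n), MonoidAlgebra.single (Equiv.Perm.sumCongr g σ) 1

open Classical in
/-- `θ_i = (1/n!) ∑ δ_h`, where `h` ranges over the double coset of the transposition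
`(i (α+1))`. For `n = 0` there is no letter `α+1` and the sum is empty. -/
def θ {α n : ℕ} (i : Fin α) : MonoidAlgebra ℂ (S α n) :=
  if hn : 0 < n then
    ((n.factorial : ℂ)⁻¹) •
      ∑ h : S α n with h ∈ DoubleCoset.doubleCoset
          (Equiv.swap (Sum.inl i) (Sum.inr ⟨0, hn⟩)) (K α n : Set (S α n)) (K α n : Set (S α n)),
        MonoidAlgebra.single h 1
  else 0

/-- `φ` takes the prescribed values `A(g) ↦ a(g)` and `Θ_i ↦ θ_i` on the generators. -/
def IsCanonical {α n : ℕ} (φ : O α (n : ℂ) →ₙₐ[ℂ] DC α n) : Prop :=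
  (∀ g : Equiv.Perm (Fin α), (φ (A g) : MonoidAlgebra ℂ (S α n)) = a g) ∧
    ∀ i : Fin α, (φ (Θ i) : MonoidAlgebra ℂ (S α n)) = θ i

end DoubleCosetAlgebra

end

/-! From the generators one builds elements `T l`, for lists `l` of distinct letters, by `T (i :: l)
= T l * Θ i - ∑_{j ∈ l} A((ij)) T l`. In the concrete algebra `T l` is the normalized indicator of
the double coset of permutations that fix the first α letters outside `l` and send those in `l` to
new letters. The commutator relation makes `T l` symmetric in `l`. The last relation makes it absorb
permutations supported on `l`. Hence `A g * T l` depends only on `g` restricted to the complement of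
`l`, a partial bijection `p`, and is called `e p`. The quadratic relation shows that the
combinations of the `e p` with coefficients polynomial in the parameter are stable under right
multiplication by generators, so the `e p` span.

Double cosets are classified by the partial bijection induced on the first α letters, and the
canonical map sends `e p` to the normalized indicator `ind p` (`coe_e`). This gives surjectivity for
every n. If n ≥ α, every partial bijection occurs, so the `e p` are independent and the map is
bijective.

To pass to arbitrary ν, right multiplication by the generators is written by matrices polynomial in
ν. The relations between these matrices hold at every integer n ≥ α, hence identically. The
resulting representation separates the `e p` for every ν, which gives the dimension.

For generic semisimplicity, let L be an algebraic closure of ℂ(X). A nonzero element of the radical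
of the algebra over L would specialize, at some integer n ≥ α, to a nonzero element generating a nil
right ideal of bounded index in `O α n`. By Maschke's theorem there is none. So the algebra over L
is a product of matrix algebras. The isomorphism and its inverse involve finitely many elements of
L, and these specialize at all but finitely many ν (`exists_specialization`), giving matrix algebras
over ℂ of the same sizes. -/

noncomputable section

namespace DoubleCosetAlgebra

/-! ### Consequences of the relations: symmetry and absorption for `T` -/

section

open Equiv Polynomial

/-- Elements `A(g)`, `Θ_i` of a ring that satisfy the defining relations of `O[α;ν]`, with the
parameter replaced by a central element `z`. -/
structure Realization (α : ℕ) (R : Type*) [Ring R] where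
  z : R
  A : Perm (Fin α) → R
  Θ : Fin α → R
  z_comm : ∀ x, z * x = x * z
  A_one : A 1 = 1
  A_mul : ∀ g₁ g₂, A g₁ * A g₂ = A (g₁ * g₂)
  conj : ∀ g i, A g * Θ i * A g⁻¹ = Θ (g i)
  sq : ∀ j, Θ j * Θ j = (z - 1) * Θ j + z
  comm : ∀ i j, i ≠ j → Θ j * Θ i - Θ i * Θ j = A (swap i j) * (Θ j - Θ i)
  swap_mul : ∀ i j, i ≠ j → (A (swap i j) - 1) * Θ j * (Θ i + 1) = 0

namespace Realization

variable {α : ℕ} {R : Type*} [Ring R] (r : Realization α R)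

theorem A_mul_Θ (g : Perm (Fin α)) (i : Fin α) : r.A g * r.Θ i = r.Θ (g i) * r.A g := by
  rw [← r.conj, mul_assoc, r.A_mul, inv_mul_cancel, r.A_one, mul_one]

/-- The sum of the `A((ij))` over `j ∈ l`. -/
def jm (i : Fin α) (l : List (Fin α)) : R := ∑ j ∈ l.toFinset, r.A (swap i j)

/-- In the concrete algebras, the operator that replaces the letters at the positions in `l` by
distinct new letters in all possible ways. -/
def T : List (Fin α) → R
  | [] => 1
  | i :: l => T l * r.Θ i - r.jm i l * T l

@[simp] theorem T_nil : r.T [] = 1 := rfl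

theorem T_cons (i : Fin α) (l : List (Fin α)) : r.T (i :: l) = r.T l * r.Θ i - r.jm i l * r.T l := rfl

theorem A_mul_jm (g : Perm (Fin α)) (i : Fin α) (l : List (Fin α)) :
    r.A g * r.jm i l = r.jm (g i) (l.map g) * r.A g := by
  have h : (l.map g).toFinset = l.toFinset.map g.toEmbedding := by
    ext
    simp only [List.mem_toFinset, List.mem_map, Finset.mem_map, Equiv.toEmbedding_apply]
  rw [jm, jm, h, Finset.sum_map, Finset.mul_sum, Finset.sum_mul]
  refine Finset.sum_congr rfl fun j _ => ?_
  rw [r.A_mul, r.A_mul]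
  congr 1
  simp [Equiv.mul_swap_eq_swap_mul]

theorem A_mul_T (g : Perm (Fin α)) (l : List (Fin α)) : r.A g * r.T l = r.T (l.map g) * r.A g := by
  induction l with
  | nil => simp
  | cons i l ih =>
    rw [List.map_cons, T_cons, T_cons, mul_sub, sub_mul, ← mul_assoc, ih, mul_assoc, A_mul_Θ,
      ← mul_assoc, ← mul_assoc, A_mul_jm, mul_assoc (r.jm _ _), ih, ← mul_assoc]

theorem A_swap_mul_T {i j : Fin α} {l : List (Fin α)} (hi : i ∉ l) (hj : j ∉ l) :
    r.A (swap i j) * r.T l = r.T l * r.A (swap i j) := by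
  rw [A_mul_T]
  congr 2
  refine (List.map_congr_left fun k hk => ?_).trans (List.map_id l)
  exact swap_apply_of_ne_of_ne (fun h => hi (h ▸ hk)) (fun h => hj (h ▸ hk))

theorem jm_cons {i j : Fin α} {l : List (Fin α)} (hj : j ∉ l) :
    r.jm i (j :: l) = r.A (swap i j) + r.jm i l := by
  rw [jm, List.toFinset_cons, Finset.sum_insert (by simpa using hj), jm]

theorem jm_congr {i : Fin α} {l l' : List (Fin α)} (h : l.Perm l') : r.jm i l = r.jm i l' := by
  rw [jm, List.toFinset_eq_of_perm _ _ h, jm]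

/-- Products of transpositions `(i k)` and `(j m)` with `k ≠ m` commute and cancel. The terms with
`k = m` are three-cycles, each equal to `(ij)` times a transposition. This parallels the defining
commutator relation, with letters of `l` in place of new letters. -/
theorem jm_comm {i j : Fin α} (hij : i ≠ j) {l : List (Fin α)} (hi : i ∉ l) (hj : j ∉ l) :
    r.jm i l * r.jm j l - r.jm j l * r.jm i l = r.A (swap i j) * (r.jm i l - r.jm j l) := by
  simp only [jm, Finset.sum_mul_sum]
  rw [Finset.sum_comm (f := fun a b => r.A (swap j a) * r.A (swap i b)), ← Finset.sum_sub_distrib,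
    ← Finset.sum_sub_distrib, Finset.mul_sum]
  refine Finset.sum_congr rfl fun k hk => ?_
  rw [← Finset.sum_sub_distrib, Finset.sum_eq_single k]
  · have hki : k ≠ i := fun h => hi (h ▸ List.mem_toFinset.1 hk)
    have hkj : k ≠ j := fun h => hj (h ▸ List.mem_toFinset.1 hk)
    rw [mul_sub, r.A_mul, r.A_mul, r.A_mul, r.A_mul]
    congr 2
    · ext x; simp only [Perm.mul_apply, swap_apply_def]; grind
    · ext x; simp only [Perm.mul_apply, swap_apply_def]; grind
  · intro m hm hmk
    have hki : k ≠ i := fun h => hi (h ▸ List.mem_toFinset.1 hk)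
    have hkj : k ≠ j := fun h => hj (h ▸ List.mem_toFinset.1 hk)
    have hmi : m ≠ i := fun h => hi (h ▸ List.mem_toFinset.1 hm)
    have hmj : m ≠ j := fun h => hj (h ▸ List.mem_toFinset.1 hm)
    rw [r.A_mul, r.A_mul, sub_eq_zero]
    congr 1
    ext x; simp only [Perm.mul_apply, swap_apply_def]; grind
  · exact fun h => (h hk).elim

/-- In the difference of the two sides, the commutator of `Θ j` and `Θ i` and that of the two `jm`
sums produce the same multiples of `A((ij))`. They cancel because `A((ij))` commutes with `T l`. -/
theorem T_swap {i j : Fin α} (hij : i ≠ j) {l : List (Fin α)} (hi : i ∉ l) (hj : j ∉ l) :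
    r.T (i :: j :: l) = r.T (j :: i :: l) := by
  have h1 := congrArg (fun x => r.T l * x) (r.comm i j hij)
  have h2 := congrArg (fun x => x * r.T l) (r.jm_comm hij hi hj)
  have h3 := r.A_swap_mul_T hi hj
  simp only [← mul_assoc, ← h3] at h1
  simp only [T_cons, r.jm_cons hi, r.jm_cons hj, swap_comm j i]
  rw [← sub_eq_zero]
  simp only [mul_sub, sub_mul, add_mul, mul_assoc] at h1 h2 ⊢
  rw [sub_eq_iff_eq_add] at h1 h2
  rw [h1, h2]
  abel

theorem T_perm {l l' : List (Fin α)} (h : l.Perm l') (hl : l.Nodup) : r.T l = r.T l' := by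
  induction h with
  | nil => rfl
  | cons i h ih =>
    rw [T_cons, T_cons, ih hl.of_cons, r.jm_congr h]
  | swap i j l =>
    simp only [List.nodup_cons, List.mem_cons, not_or] at hl
    exact r.T_swap hl.1.1 hl.1.2 hl.2.1
  | trans h₁ _ ih₁ ih₂ => exact (ih₁ hl).trans (ih₂ (h₁.nodup_iff.1 hl))

/-- For two letters this is exactly the last defining relation, rewritten using `A((ij))² = 1`. A
further letter `m` is moved to the front by symmetry, where `A((ij))` commutes with `jm m (i :: j ::
l)` since it only permutes the summands. -/
theorem A_swap_mul_T_cons {i j : Fin α} {l : List (Fin α)} (hl : (i :: j :: l).Nodup) :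
    r.A (swap i j) * r.T (i :: j :: l) = r.T (i :: j :: l) := by
  induction l with
  | nil =>
    have hij : i ≠ j := by simpa using hl
    have h := r.swap_mul i j hij
    have h2 : r.A (swap i j) * r.A (swap i j) = 1 := by rw [r.A_mul, swap_mul_self, r.A_one]
    have h3 : r.A (swap i j) * (r.A (swap i j) * r.Θ j) = r.Θ j := by rw [← mul_assoc, h2, one_mul]
    have h4 : r.T [i, j] = r.Θ j * r.Θ i - r.A (swap i j) * r.Θ j := by
      simp [T_cons, jm]
    rw [h4, ← sub_eq_zero, ← h]
    simp only [mul_sub, sub_mul, mul_add, mul_assoc, h3]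
    noncomm_ring
  | cons m l ih =>
    have hp : (i :: j :: m :: l).Perm (m :: i :: j :: l) :=
      ((List.Perm.swap m j l).cons i).trans (List.Perm.swap m i _)
    have hn := hp.nodup_iff.1 hl
    have hm := (List.nodup_cons.1 hn).1
    have ih := ih hn.of_cons
    have hc : r.A (swap i j) * r.jm m (i :: j :: l) = r.jm m (i :: j :: l) * r.A (swap i j) := by
      rw [A_mul_jm]
      simp only [List.mem_cons, not_or] at hm
      rw [swap_apply_of_ne_of_ne hm.1 hm.2.1]
      congr 1
      refine r.jm_congr ?_
      simp only [List.nodup_cons, List.mem_cons, not_or] at hn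
      have : l.map (swap i j) = l := by
        refine (List.map_congr_left fun k hk => ?_).trans (List.map_id l)
        exact swap_apply_of_ne_of_ne (fun h => hn.2.1.2 (h ▸ hk)) (fun h => hn.2.2.1 (h ▸ hk))
      simp only [List.map_cons, swap_apply_left, swap_apply_right, this]
      exact List.Perm.swap _ _ _
    rw [r.T_perm hp hl, T_cons, mul_sub, ← mul_assoc, ih, ← mul_assoc, hc, mul_assoc, ih]

theorem A_swap_mul_T_of_mem {i j : Fin α} (hij : i ≠ j) {l : List (Fin α)} (hl : l.Nodup)
    (hi : i ∈ l) (hj : j ∈ l) : r.A (swap i j) * r.T l = r.T l := by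
  have hp : l.Perm (i :: j :: (l.erase i).erase j) :=
    (List.perm_cons_erase hi).trans
      ((List.perm_cons_erase ((List.mem_erase_of_ne hij.symm).2 hj)).cons i)
  rw [r.T_perm hp hl]
  exact r.A_swap_mul_T_cons (hp.nodup_iff.1 hl)

/-- Such a `g` is a permutation of the letters of `l`, hence a product of transpositions that are
each absorbed. -/
theorem A_mul_T_of_fixes {l : List (Fin α)} (hl : l.Nodup) (g : Perm (Fin α))
    (hg : ∀ i, i ∉ l → g i = i) : r.A g * r.T l = r.T l := by
  have key : ∀ f : Perm {x // x ∈ l}, r.A (Perm.ofSubtype f) * r.T l = r.T l := by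
    intro f
    refine Perm.swap_induction_on f (by simp [r.A_one]) fun f x y hxy ih => ?_
    rw [map_mul, ← r.A_mul, mul_assoc, ih, Perm.ofSubtype_swap_eq]
    exact r.A_swap_mul_T_of_mem (fun h => hxy (Subtype.ext h)) hl x.2 y.2
  have hp : ∀ x, g x ∈ l ↔ x ∈ l := by
    intro x
    by_cases hx : x ∈ l
    · simp only [hx, iff_true]
      by_contra h
      exact h (by rwa [g.injective (hg _ h)])
    · simp [hg x hx, hx]
  have := key (Perm.subtypePerm g hp)
  rwa [Perm.ofSubtype_subtypePerm] at this
  intro x hx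
  by_contra h
  exact hx (hg x h)

end Realization

end

/-! ### Partial bijections and the spanning elements `e p` -/

section

open Equiv Polynomial

/-- Partial bijections of `α` letters, as partial functions. -/
abbrev PB (α : ℕ) : Type :=
  {f : Fin α → Option (Fin α) // ∀ j j' i, f j = some i → f j' = some i → j = j'}

instance (α : ℕ) : Fintype (PB α) := Fintype.ofFinite _

theorem card_PB (α : ℕ) : Fintype.card (PB α) = (partialBijections α).ncard := by
  classical
  let F : PB α → Matrix (Fin α) (Fin α) ℂ := fun p i j => if p.1 j = some i then 1 else 0
  have hF : Function.Injective F := by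
    intro p q h
    ext j i
    have := congrFun (congrFun h i) j
    by_cases h1 : p.1 j = some i <;> by_cases h2 : q.1 j = some i <;> simp_all [F]
  have hr : Set.range F = partialBijections α := by
    ext M
    constructor
    · rintro ⟨p, rfl⟩
      refine ⟨fun i j => ?_, fun i j j' h h' => ?_, fun i i' j h h' => ?_⟩
      · by_cases h : p.1 j = some i <;> simp [F, h]
      · refine p.2 j j' i ?_ ?_ <;> by_contra hc <;> simp_all [F]
      · have h1 : p.1 j = some i := by by_contra hc; simp_all [F]
        have h2 : p.1 j = some i' := by by_contra hc; simp_all [F]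
        exact Option.some_injective _ (h1.symm.trans h2)
    · rintro ⟨h1, h2, h3⟩
      let f : Fin α → Option (Fin α) := fun j =>
        if h : ∃ i, M i j = 1 then some h.choose else none
      have hf : ∀ i j, f j = some i ↔ M i j = 1 := by
        intro i j
        by_cases h : ∃ i, M i j = 1
        · simp only [f, h, dite_true, Option.some.injEq]
          exact ⟨fun hh => hh ▸ h.choose_spec, fun hh => h3 _ _ j h.choose_spec hh⟩
        · simp only [f, h, dite_false, reduceCtorEq, false_iff]
          exact fun hh => h ⟨i, hh⟩
      refine ⟨⟨f, fun j j' i h h' => h2 i j j' ((hf _ _).1 h) ((hf _ _).1 h')⟩, ?_⟩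
      ext i j
      by_cases h : M i j = 1
      · simp [F, (hf i j).2 h, h]
      · have : ¬ f j = some i := fun hh => h ((hf i j).1 hh)
        simp [F, this, (h1 i j).resolve_right h]
  rw [← hr, ← Set.image_univ, Set.ncard_image_of_injective _ hF, Set.ncard_univ,
    Nat.card_eq_fintype_card]

/-- The restriction of a permutation to the complement of `l`. -/
def restr {α : ℕ} (g : Perm (Fin α)) (l : List (Fin α)) : PB α :=
  ⟨fun j => if j ∈ l then none else some (g j), by
    intro j j' i h h'
    simp only [Option.ite_none_left_eq_some, Option.some.injEq] at h h'
    exact g.injective (h.2.trans h'.2.symm)⟩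

theorem exists_restr_eq {α : ℕ} (p : PB α) :
    ∃ (g : Perm (Fin α)) (l : List (Fin α)), l.Nodup ∧ restr g l = p := by
  classical
  obtain ⟨g, hg⟩ := Set.MapsTo.exists_equiv_extend_of_card_eq (α := Fin α) (β := Fin α)
    (t := Finset.univ) (by simp) (s := {j | p.1 j ≠ none}) (f := fun j => (p.1 j).getD j)
    (fun _ _ => by simp) (by
      intro j hj j' hj' h
      obtain ⟨i, hi⟩ := Option.ne_none_iff_exists'.1 hj
      obtain ⟨i', hi'⟩ := Option.ne_none_iff_exists'.1 hj'
      simp only [hi, hi', Option.getD_some] at h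
      exact p.2 j j' i hi (h ▸ hi'))
  refine ⟨g.trans (Equiv.subtypeUnivEquiv (by simp)),
    (Finset.univ.filter fun j => p.1 j = none).toList, Finset.nodup_toList _, ?_⟩
  refine Subtype.ext (funext fun j => ?_)
  rcases h : p.1 j with _ | i
  · simp [restr, h]
  · have := hg j (by simp [h])
    simp [restr, h, this]

/-- A permutation that extends a partial bijection. -/
def permOf {α : ℕ} (p : PB α) : Perm (Fin α) := (exists_restr_eq p).choose

/-- The letters on which a partial bijection is not defined. -/
def listOf {α : ℕ} (p : PB α) : List (Fin α) := (exists_restr_eq p).choose_spec.choose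

theorem nodup_listOf {α : ℕ} (p : PB α) : (listOf p).Nodup :=
  (exists_restr_eq p).choose_spec.choose_spec.1

theorem restr_permOf_listOf {α : ℕ} (p : PB α) : restr (permOf p) (listOf p) = p :=
  (exists_restr_eq p).choose_spec.choose_spec.2

namespace Realization

variable {α : ℕ} {R : Type*} [Ring R] (r : Realization α R)

/-- Equal restrictions force `l` and `l'` to have the same letters, and then `g'⁻¹ * g` is supported
on `l` and is absorbed by `T l`. This makes `e` independent of the chosen extension and list. -/
theorem A_mul_T_congr {g g' : Perm (Fin α)} {l l' : List (Fin α)} (hl : l.Nodup) (hl' : l'.Nodup)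
    (h : restr g l = restr g' l') : r.A g * r.T l = r.A g' * r.T l' := by
  have h1 : ∀ j, (if j ∈ l then none else some (g j)) = if j ∈ l' then none else some (g' j) :=
    fun j => congrFun (congrArg Subtype.val h) j
  have hm : ∀ j, j ∈ l ↔ j ∈ l' := by
    intro j
    have := h1 j
    by_cases a : j ∈ l <;> by_cases b : j ∈ l' <;> simp_all
  have hp : l.Perm l' := (List.perm_ext_iff_of_nodup hl hl').2 hm
  rw [← r.T_perm hp hl]
  have h2 : r.A (g'⁻¹ * g) * r.T l = r.T l := by
    refine r.A_mul_T_of_fixes hl _ fun i hi => ?_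
    have := h1 i
    rw [if_neg hi, if_neg (fun h => hi ((hm i).2 h))] at this
    rw [Perm.mul_apply, Option.some_injective _ this, Perm.inv_def, symm_apply_apply]
  nth_rw 2 [← h2]
  rw [← mul_assoc, r.A_mul, mul_inv_cancel_left]

/-- The element attached to a partial bijection. -/
def e (p : PB α) : R := r.A (permOf p) * r.T (listOf p)

theorem A_mul_T_eq_e (g : Perm (Fin α)) {l : List (Fin α)} (hl : l.Nodup) :
    r.A g * r.T l = r.e (restr g l) :=
  r.A_mul_T_congr hl (nodup_listOf _) (restr_permOf_listOf _).symm

theorem e_one : r.e (restr 1 []) = 1 := by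
  rw [← r.A_mul_T_eq_e 1 List.nodup_nil, r.A_one, T_nil, one_mul]

section Map

variable {R' : Type*} [Ring R'] (r' : Realization α R') (f : R →+* R')

theorem map_T (hA : ∀ g, f (r.A g) = r'.A g) (hΘ : ∀ i, f (r.Θ i) = r'.Θ i) (l : List (Fin α)) :
    f (r.T l) = r'.T l := by
  induction l with
  | nil => simp
  | cons i l ih => simp [T_cons, ih, hΘ, jm, hA]

/-- Naturality of `e`: all comparisons between the abstract, concrete and generic algebras go
through it. -/
theorem map_e (hA : ∀ g, f (r.A g) = r'.A g) (hΘ : ∀ i, f (r.Θ i) = r'.Θ i) (p : PB α) :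
    f (r.e p) = r'.e p := by
  rw [e, e, map_mul, hA, r.map_T r' f hA hΘ]

end Map

/-- The image of a realization under a ring homomorphism that keeps `z` central. -/
def map {R' : Type*} [Ring R'] (f : R →+* R') (hz : ∀ x, f r.z * x = x * f r.z) :
    Realization α R' where
  z := f r.z
  A g := f (r.A g)
  Θ i := f (r.Θ i)
  z_comm := hz
  A_one := by rw [r.A_one, map_one]
  A_mul g₁ g₂ := by rw [← map_mul, r.A_mul]
  conj g i := by rw [← map_mul, ← map_mul, r.conj]
  sq j := by rw [← map_mul, r.sq]; simp
  comm i j h := by rw [← map_mul, ← map_mul, ← map_sub, r.comm i j h]; simp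
  swap_mul i j h := by rw [← map_zero f, ← r.swap_mul i j h]; simp

section Span

variable [Algebra ℂ R]

/-- Linear combinations of the `e p` with coefficients polynomial in `z`. -/
def comb : (PB α → ℂ[X]) →ₗ[ℂ] R where
  toFun c := ∑ q, aeval r.z (c q) * r.e q
  map_add' c d := by simp [add_mul, Finset.sum_add_distrib]
  map_smul' c d := by simp [Finset.smul_sum]

theorem comb_apply (c : PB α → ℂ[X]) : r.comb c = ∑ q, aeval r.z (c q) * r.e q := rfl

theorem e_mem (p : PB α) : r.e p ∈ r.comb.range := by
  classical
  refine ⟨Pi.single p 1, ?_⟩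
  rw [comb_apply, Finset.sum_eq_single p]
  · simp
  · intro q _ hq; simp [Pi.single_eq_of_ne hq]
  · simp

theorem A_mul_T_mem (g : Perm (Fin α)) {l : List (Fin α)} (hl : l.Nodup) :
    r.A g * r.T l ∈ r.comb.range := by
  rw [r.A_mul_T_eq_e g hl]; exact r.e_mem _

theorem T_mem {l : List (Fin α)} (hl : l.Nodup) : r.T l ∈ r.comb.range := by
  have := r.A_mul_T_mem 1 hl
  rwa [r.A_one, one_mul] at this

theorem z_mul_mem {x : R} (hx : x ∈ r.comb.range) : r.z * x ∈ r.comb.range := by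
  obtain ⟨c, rfl⟩ := hx
  refine ⟨fun q => X * c q, ?_⟩
  simp [comb_apply, Finset.mul_sum, mul_assoc]

theorem aeval_z_mul_comm (f : ℂ[X]) (x : R) : aeval r.z f * x = x * aeval r.z f := by
  induction f using Polynomial.induction_on' with
  | add p q hp hq => simp [add_mul, mul_add, hp, hq]
  | monomial n c =>
    simp only [aeval_monomial]
    rw [mul_assoc, (Commute.pow_left (show Commute r.z x from r.z_comm x) n).eq, ← mul_assoc,
      Algebra.commutes, mul_assoc]

theorem aeval_mul_mem (f : ℂ[X]) {x : R} (hx : x ∈ r.comb.range) :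
    aeval r.z f * x ∈ r.comb.range := by
  obtain ⟨c, rfl⟩ := hx
  refine ⟨fun q => f * c q, ?_⟩
  simp [comb_apply, Finset.mul_sum, mul_assoc]

theorem A_mul_mem (g : Perm (Fin α)) {x : R} (hx : x ∈ r.comb.range) :
    r.A g * x ∈ r.comb.range := by
  obtain ⟨c, rfl⟩ := hx
  rw [comb_apply, Finset.mul_sum]
  refine Submodule.sum_mem _ fun q _ => ?_
  rw [← mul_assoc, ← aeval_z_mul_comm, mul_assoc, e, ← mul_assoc (r.A _), r.A_mul]
  exact r.aeval_mul_mem _ (r.A_mul_T_mem _ (nodup_listOf q))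

theorem jm_mul_mem (i : Fin α) (l : List (Fin α)) {x : R} (hx : x ∈ r.comb.range) :
    r.jm i l * x ∈ r.comb.range := by
  rw [jm, Finset.sum_mul]
  exact Submodule.sum_mem _ fun j _ => r.A_mul_mem _ hx

/-- If `i ∉ l`, the recursion for `T (i :: l)` expresses the product. If `i ∈ l`, move `i` to the
front; the factor `Θ i * Θ i` that appears is reduced by the quadratic relation to the first case.
-/
theorem T_mul_Θ_mem {l : List (Fin α)} (hl : l.Nodup) (i : Fin α) :
    r.T l * r.Θ i ∈ r.comb.range := by
  have key : ∀ l : List (Fin α), l.Nodup → i ∉ l → r.T l * r.Θ i ∈ r.comb.range := by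
    intro l hl hi
    have h := r.T_cons i l
    rw [eq_sub_iff_add_eq] at h
    rw [← h]
    exact Submodule.add_mem _ (r.T_mem (List.nodup_cons.2 ⟨hi, hl⟩)) (r.jm_mul_mem _ _ (r.T_mem hl))
  by_cases hi : i ∈ l
  · have hp := List.perm_cons_erase hi
    have hn := hp.nodup_iff.1 hl
    have h1 := key _ hn.of_cons (List.nodup_cons.1 hn).1
    rw [r.T_perm hp hl, T_cons, sub_mul, mul_assoc, r.sq, mul_assoc, mul_add, ← mul_assoc, mul_sub,
      mul_one, ← r.z_comm, sub_mul, mul_assoc]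
    refine Submodule.sub_mem _ (Submodule.add_mem _ (Submodule.sub_mem _ ?_ ?_) ?_) ?_
    · exact r.z_mul_mem h1
    · exact h1
    · exact r.z_mul_mem (r.T_mem hn.of_cons)
    · exact r.jm_mul_mem _ _ h1
  · exact key l hl hi

theorem mul_Θ_mem {x : R} (hx : x ∈ r.comb.range) (i : Fin α) : x * r.Θ i ∈ r.comb.range := by
  obtain ⟨c, rfl⟩ := hx
  rw [comb_apply, Finset.sum_mul]
  refine Submodule.sum_mem _ fun q _ => ?_
  rw [mul_assoc, e, mul_assoc]
  exact r.aeval_mul_mem _ (r.A_mul_mem _ (r.T_mul_Θ_mem (nodup_listOf q) i))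

theorem mul_A_mem {x : R} (hx : x ∈ r.comb.range) (g : Perm (Fin α)) :
    x * r.A g ∈ r.comb.range := by
  obtain ⟨c, rfl⟩ := hx
  rw [comb_apply, Finset.sum_mul]
  refine Submodule.sum_mem _ fun q _ => ?_
  have h : r.T (listOf q) * r.A g = r.A g * r.T ((listOf q).map ⇑g⁻¹) := by
    rw [A_mul_T, List.map_map]
    congr 2
    exact ((List.map_congr_left fun k _ => by simp).trans (List.map_id _)).symm
  rw [mul_assoc, e, mul_assoc, h, ← mul_assoc (r.A _), r.A_mul]
  exact r.aeval_mul_mem _ (r.A_mul_T_mem _ ((nodup_listOf q).map (Equiv.injective _)))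

end Span

end Realization

end

/-! ### The presented algebra: universal property and spanning set -/

section

open Equiv Polynomial

variable {α : ℕ} {ν : ℂ}

theorem mk_rel {x y : FreeAlgebra ℂ (Gen α)} (h : Rel α ν x y) :
    RingQuot.mkAlgHom ℂ (Rel α ν) x = RingQuot.mkAlgHom ℂ (Rel α ν) y :=
  RingQuot.mkAlgHom_rel ℂ h

theorem mk_freeA (g : Perm (Fin α)) : RingQuot.mkAlgHom ℂ (Rel α ν) (freeA g) = A g := rfl

theorem mk_freeΘ (i : Fin α) : RingQuot.mkAlgHom ℂ (Rel α ν) (freeΘ i) = Θ i := rfl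

theorem A_one : (A 1 : O α ν) = 1 := by
  rw [A, mk_rel (Rel.one), map_one]

variable (α ν) in
/-- The tautological realization of `O[α;ν]`. -/
@[simps] def tautological : Realization α (O α ν) where
  z := algebraMap ℂ _ ν
  A := A
  Θ := Θ
  z_comm := Algebra.commutes ν
  A_one := A_one
  A_mul g₁ g₂ := by simp only [A]; rw [← map_mul, mk_rel (Rel.mul g₁ g₂)]
  conj g i := by simp only [A, Θ]; rw [← map_mul, ← map_mul, mk_rel (Rel.conj g i)]
  sq j := by
    have := mk_rel (ν := ν) (Rel.sq j)
    rw [map_add, map_mul, map_smul, map_smul] at this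
    rw [Θ, this, ← A, A_one, Algebra.smul_def, Algebra.smul_def, map_sub, map_one, mul_one]
  comm i j h := by simpa only [map_sub, map_mul, mk_freeA, mk_freeΘ] using mk_rel (ν := ν) (Rel.comm i j h)
  swap_mul i j h := by
    simpa only [map_sub, map_mul, map_add, map_zero, mk_freeA, mk_freeΘ, A_one] using
      mk_rel (ν := ν) (Rel.swap i j h)

theorem O_induction {P : O α ν → Prop} (hc : ∀ c : ℂ, P (algebraMap ℂ _ c)) (hA : ∀ g, P (A g))
    (hΘ : ∀ i, P (Θ i)) (hadd : ∀ x y, P x → P y → P (x + y))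
    (hmul : ∀ x y, P x → P y → P (x * y)) (x : O α ν) : P x := by
  obtain ⟨x, rfl⟩ := RingQuot.mkAlgHom_surjective ℂ (Rel α ν) x
  induction x using FreeAlgebra.induction with
  | grade0 c => rw [AlgHom.commutes]; exact hc c
  | grade1 x =>
    cases x with
    | A g => exact hA g
    | Θ i => exact hΘ i
  | mul x y hx hy => rw [map_mul]; exact hmul _ _ hx hy
  | add x y hx hy => rw [map_add]; exact hadd _ _ hx hy

section Lift

variable {R : Type*} [Ring R] [Algebra ℂ R] (r : Realization α R) (hz : r.z = algebraMap ℂ R ν)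

/-- The values of a realization on the generators. -/
def Realization.gen {R : Type*} [Ring R] (r : Realization α R) : Gen α → R
  | .A g => r.A g
  | .Θ i => r.Θ i

/-- The homomorphism from `O[α;ν]` given by a realization. -/
def Realization.lift : O α ν →ₐ[ℂ] R :=
  RingQuot.liftAlgHom ℂ ⟨FreeAlgebra.lift ℂ r.gen, by
    intro x y h
    cases h with
    | one => simp [freeA, Realization.gen, r.A_one]
    | mul g₁ g₂ => simp [freeA, Realization.gen, r.A_mul]
    | conj g i => simp [freeA, freeΘ, Realization.gen, r.conj]
    | sq j =>
      simp [freeA, freeΘ, Realization.gen, r.sq, r.A_one, hz, Algebra.smul_def, sub_mul]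
    | comm i j h => simp [freeA, freeΘ, Realization.gen, r.comm i j h]
    | swap i j h => simp [freeA, freeΘ, Realization.gen, r.A_one, r.swap_mul i j h]⟩

@[simp] theorem Realization.lift_A (g : Perm (Fin α)) : r.lift hz (DoubleCosetAlgebra.A g) = r.A g := by
  simp [Realization.lift, DoubleCosetAlgebra.A, freeA, Realization.gen]

@[simp] theorem Realization.lift_Θ (i : Fin α) : r.lift hz (DoubleCosetAlgebra.Θ i) = r.Θ i := by
  simp [Realization.lift, DoubleCosetAlgebra.Θ, freeΘ, Realization.gen]

theorem Realization.lift_e (p : PB α) : r.lift hz ((tautological α ν).e p) = r.e p :=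
  (tautological α ν).map_e r (r.lift hz : O α ν →+* R) (r.lift_A hz) (r.lift_Θ hz) p

end Lift

theorem comb_tautological (c : PB α → ℂ[X]) :
    (tautological α ν).comb c = ∑ q, (c q).eval ν • (tautological α ν).e q := by
  rw [Realization.comb_apply]
  refine Finset.sum_congr rfl fun q _ => ?_
  rw [tautological_z, aeval_algebraMap_apply, Algebra.smul_def, coe_aeval_eq_eval]

/-- The range contains 1 and is stable under right multiplication by scalars and generators. -/
theorem range_comb_tautological : (tautological α ν).comb.range = ⊤ := by
  have key : ∀ x : O α ν, ∀ y ∈ (tautological α ν).comb.range,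
      y * x ∈ (tautological α ν).comb.range := by
    intro x
    induction x using O_induction with
    | hc c =>
      intro y hy
      rw [← Algebra.commutes, ← Algebra.smul_def]
      exact Submodule.smul_mem _ c hy
    | hA g => exact fun y hy => (tautological α ν).mul_A_mem hy g
    | hΘ i => exact fun y hy => (tautological α ν).mul_Θ_mem hy i
    | hadd a b ha hb => exact fun y hy => by rw [mul_add]; exact add_mem (ha y hy) (hb y hy)
    | hmul a b ha hb => exact fun y hy => by rw [← mul_assoc]; exact hb _ (ha y hy)
  rw [eq_top_iff]
  intro x _
  have := key x 1 ((tautological α ν).T_mem List.nodup_nil)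
  rwa [one_mul] at this

theorem span_e : Submodule.span ℂ (Set.range (tautological α ν).e) = ⊤ := by
  rw [eq_top_iff, ← range_comb_tautological]
  rintro _ ⟨c, rfl⟩
  rw [comb_tautological]
  exact Submodule.sum_mem _ fun q _ => Submodule.smul_mem _ _ (Submodule.subset_span ⟨q, rfl⟩)

instance : Module.Finite ℂ (O α ν) :=
  ⟨⟨Set.finite_range (tautological α ν).e |>.toFinset, by simpa using span_e⟩⟩

end

/-! ### Classification of double cosets by partial bijections -/

section

open Equiv Polynomial

variable {α n : ℕ}

theorem mem_K_iff {k : S α n} : k ∈ K α n ↔ ∀ j, k (Sum.inl j) = Sum.inl j := by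
  constructor
  · rintro ⟨σ, rfl⟩ j
    simp
  · intro h
    have hm : Set.MapsTo k (Set.range (Sum.inl : Fin α → Fin α ⊕ Fin n)) (Set.range Sum.inl) := by
      rintro _ ⟨j, rfl⟩
      exact ⟨j, (h j).symm⟩
    obtain ⟨⟨g, σ⟩, hk⟩ := Perm.mem_sumCongrHom_range_of_perm_mapsTo_inl hm
    refine ⟨σ, ?_⟩
    have hg : g = 1 := by
      ext j
      have := h j
      rw [← hk] at this
      simpa using congrArg (fun x => (x.getLeft?.map Fin.val)) this
    rw [← hk, hg]
    rfl

/-- The partial bijection induced by a permutation of `α + n` letters on the first `α` letters. -/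
def typ (h : S α n) : PB α :=
  ⟨fun j => (h (Sum.inl j)).getLeft?, fun j j' i hj hj' => by
    rw [Sum.getLeft?_eq_some_iff] at hj hj'
    exact Sum.inl_injective (h.injective (hj.trans hj'.symm))⟩

theorem typ_eq_iff {h : S α n} {p : PB α} : typ h = p ↔ ∀ j, (h (Sum.inl j)).getLeft? = p.1 j := by
  rw [Subtype.ext_iff, funext_iff]; rfl

theorem getLeft?_of_mem_K {k : S α n} (hk : k ∈ K α n) (x : Fin α ⊕ Fin n) :
    (k x).getLeft? = x.getLeft? := by
  rw [mem_K_iff] at hk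
  rcases x with j | y
  · rw [hk]
  · rcases h : k (Sum.inr y) with j | y'
    · rw [← hk j] at h
      cases k.injective h
    · rfl

theorem typ_mul_mul {k k' : S α n} (hk : k ∈ K α n) (hk' : k' ∈ K α n) (h : S α n) :
    typ (k * h * k') = typ h := by
  rw [typ_eq_iff]
  intro j
  rw [Perm.mul_apply, Perm.mul_apply, mem_K_iff.1 hk', getLeft?_of_mem_K hk]
  rfl

/-- Where `h` and `h'` keep a letter among the first α they agree. The other values lie among the
last n letters, and an injection between those values extends to a permutation `τ` of the n letters.
Then `τ h` and `h'` agree on the first α letters and differ by a right factor in `K`. -/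
theorem exists_eq_of_typ_eq {h h' : S α n} (ht : typ h = typ h') :
    ∃ k ∈ K α n, ∃ k' ∈ K α n, h' = k * h * k' := by
  classical
  rw [typ_eq_iff] at ht
  obtain ⟨σ, hσ⟩ := Set.MapsTo.exists_equiv_extend_of_card_eq (α := Fin n) (β := Fin n)
    (t := Finset.univ) (by simp) (s := {y | ∃ j, h (Sum.inl j) = Sum.inr y})
    (f := fun y => (h' (h.symm (Sum.inr y))).getRight?.getD y)
    (fun _ _ => by simp) (by
      rintro y ⟨j, hj⟩ y' ⟨j', hj'⟩ hy
      have h1 := ht j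
      have h2 := ht j'
      rw [hj] at h1
      rw [hj'] at h2
      have e1 : ∀ z, (h' z).getLeft? = none → ∃ w, h' z = Sum.inr w := fun z hz => by
        rcases h3 : h' z with a | b
        · rw [h3] at hz; cases hz
        · exact ⟨b, rfl⟩
      obtain ⟨w, hw⟩ := e1 _ h1.symm
      obtain ⟨w', hw'⟩ := e1 _ h2.symm
      simp only [← hj, ← hj', symm_apply_apply, hw, hw', Sum.getRight?_inr, Option.getD_some] at hy
      have : h' (Sum.inl j) = h' (Sum.inl j') := by rw [hw, hw', hy]
      rw [h'.injective this, hj'] at hj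
      exact (Sum.inr_injective hj).symm)
  let τ : Perm (Fin n) := σ.trans (Equiv.subtypeUnivEquiv (by simp))
  have hτ : ∀ y, ((σ y : Fin n)) = τ y := fun y => rfl
  have hk : sumCongr 1 τ ∈ K α n := mem_K_iff.2 fun j => by simp
  refine ⟨sumCongr 1 τ, hk, (sumCongr 1 τ * h)⁻¹ * h', mem_K_iff.2 fun j => ?_,
    (mul_inv_cancel_left _ _).symm⟩
  rw [Perm.mul_apply, Perm.inv_eq_iff_eq, Perm.mul_apply]
  have h1 : _ = (h' (Sum.inl j)).getLeft? := ht j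
  rcases h2 : h (Sum.inl j) with i | y
  · rw [h2] at h1
    rw [(Sum.getLeft?_eq_some_iff).1 h1.symm]
    simp
  · rw [h2] at h1
    have h4 := hσ y ⟨j, h2⟩
    rw [← h2, symm_apply_apply, hτ] at h4
    rcases h3 : h' (Sum.inl j) with a | b
    · rw [h3] at h1; cases h1
    · rw [h3] at h4
      simp [h4]

/-- When n ≥ α there is room to send each undefined letter `j` to its own new letter. The resulting
injection extends to a permutation. -/
theorem exists_typ_eq (hn : α ≤ n) (p : PB α) : ∃ h : S α n, typ h = p := by
  classical
  let f : Fin α ⊕ Fin n → Fin α ⊕ Fin n := fun x =>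
    x.elim (fun j => (p.1 j).elim (Sum.inr (Fin.castLE hn j)) Sum.inl) Sum.inr
  obtain ⟨g, hg⟩ := Set.MapsTo.exists_equiv_extend_of_card_eq (α := Fin α ⊕ Fin n)
    (β := Fin α ⊕ Fin n) (t := Finset.univ) (by simp) (s := Set.range Sum.inl) (f := f)
    (fun _ _ => by simp) (by
      rintro _ ⟨j, rfl⟩ _ ⟨j', rfl⟩ h
      rcases h1 : p.1 j with _ | i <;> rcases h2 : p.1 j' with _ | i' <;>
        simp only [f, Sum.elim_inl, h1, h2, Option.elim_none, Option.elim_some, Sum.inr.injEq,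
          Sum.inl.injEq, reduceCtorEq] at h
      · exact congrArg _ (Fin.castLE_injective hn h)
      · exact congrArg _ (p.2 j j' i h1 (h ▸ h2)))
  refine ⟨g.trans (Equiv.subtypeUnivEquiv (by simp)), typ_eq_iff.2 fun j => ?_⟩
  have := hg _ ⟨j, rfl⟩
  rcases h1 : p.1 j with _ | i <;> simp [this, f, h1]

/-- The normalized indicator function of a double coset. -/
def ind (p : PB α) : MonoidAlgebra ℂ (S α n) := by
  classical exact (n.factorial : ℂ)⁻¹ • ∑ h : S α n with typ h = p, MonoidAlgebra.single h 1

theorem coeff_sum_single {G : Type*} [DecidableEq G] (s : Finset G) (h : G) :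
    (∑ g ∈ s, MonoidAlgebra.single g (1 : ℂ)).coeff h = if h ∈ s then 1 else 0 := by
  simp [MonoidAlgebra.coeff_sum, Finsupp.single_apply]

open Classical in
theorem coeff_ind (p : PB α) (h : S α n) :
    (ind p).coeff h = if typ h = p then (n.factorial : ℂ)⁻¹ else 0 := by
  rw [ind, MonoidAlgebra.coeff_smul_apply, coeff_sum_single]
  simp

theorem typ_eq_restr_nil_iff {h : S α n} {g : Perm (Fin α)} :
    typ h = restr g [] ↔ ∃ σ : Perm (Fin n), sumCongr g σ = h := by
  constructor
  · intro ht
    rw [typ_eq_iff] at ht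
    have hk : sumCongr g⁻¹ 1 * h ∈ K α n := by
      refine mem_K_iff.2 fun j => ?_
      rw [Perm.mul_apply,
        (Sum.getLeft?_eq_some_iff).1 ((ht j).trans (show _ = some (g j) by simp [restr]))]
      simp
    obtain ⟨σ, hσ⟩ := hk
    refine ⟨σ, ?_⟩
    rw [← mul_right_inj (sumCongr g⁻¹ (1 : Perm (Fin n))), ← hσ, Perm.sumCongr_mul]
    simp
  · rintro ⟨σ, rfl⟩
    rw [typ_eq_iff]
    intro j
    simp [restr]

theorem a_eq_ind (g : Perm (Fin α)) : (a g : MonoidAlgebra ℂ (S α n)) = ind (restr g []) := by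
  classical
  rw [a, ind]
  congr 1
  refine Finset.sum_bij (fun σ _ => sumCongr g σ) ?_ ?_ ?_ ?_
  · intro σ _
    simpa using typ_eq_restr_nil_iff.2 ⟨σ, rfl⟩
  · intro σ _ τ _ h
    ext y
    simpa using congrArg (fun x => (x.getRight?.map Fin.val)) (congrArg (· (Sum.inr y)) h)
  · intro h hh
    obtain ⟨σ, hσ⟩ := typ_eq_restr_nil_iff.1 (Finset.mem_filter.1 hh).2
    exact ⟨σ, Finset.mem_univ _, hσ⟩
  · intro σ _; rfl

theorem θ_eq_ind (i : Fin α) : (θ i : MonoidAlgebra ℂ (S α n)) = ind (restr 1 [i]) := by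
  classical
  have hr : ∀ h : S α n, typ h = restr 1 [i] → 0 < n := by
    intro h ht
    have := typ_eq_iff.1 ht i
    rcases h1 : h (Sum.inl i) with a | b
    · rw [h1] at this; simp [restr] at this
    · exact b.pos
  by_cases hn : 0 < n
  · have ht : typ (swap (Sum.inl i) (Sum.inr (⟨0, hn⟩ : Fin n))) = restr 1 [i] := by
      rw [typ_eq_iff]
      intro j
      by_cases hj : j = i
      · simp [hj, restr]
      · simp [restr, hj, swap_apply_of_ne_of_ne]
    rw [θ, dif_pos hn, ind]
    congr 1
    refine Finset.sum_congr ?_ fun _ _ => rfl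
    ext h
    simp only [Finset.mem_filter, Finset.mem_univ, true_and, DoubleCoset.mem_doubleCoset,
      SetLike.mem_coe]
    constructor
    · rintro ⟨k, hk, k', hk', rfl⟩
      rw [typ_mul_mul hk hk', ht]
    · intro h'
      exact exists_eq_of_typ_eq (ht.trans h'.symm)
  · rw [θ, dif_neg hn]
    ext h
    rw [coeff_ind, if_neg fun h' => hn (hr h h')]
    rfl

end

/-! ### The realization in the double coset algebra -/

section

open Equiv Polynomial

variable {α n : ℕ}

theorem ind_mem (p : PB α) : (ind p : MonoidAlgebra ℂ (S α n)) ∈ biinvariant (K α n) := by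
  classical
  intro k hk k' hk' g
  rw [coeff_ind, coeff_ind, typ_mul_mul hk hk']

theorem a_mem (g : Perm (Fin α)) : (a g : MonoidAlgebra ℂ (S α n)) ∈ biinvariant (K α n) := by
  rw [a_eq_ind]; exact ind_mem _

theorem θ_mem (i : Fin α) : (θ i : MonoidAlgebra ℂ (S α n)) ∈ biinvariant (K α n) := by
  rw [θ_eq_ind]; exact ind_mem _

/-- The delta function of a permutation. -/
abbrev δ (h : S α n) : MonoidAlgebra ℂ (S α n) := MonoidAlgebra.single h 1

theorem δ_mul (h h' : S α n) : δ h * δ h' = δ (h * h') := by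
  rw [MonoidAlgebra.single_mul_single, mul_one]

theorem δ_one : (δ 1 : MonoidAlgebra ℂ (S α n)) = 1 := rfl

theorem mem_K_of (σ : Perm (Fin n)) : sumCongr (1 : Perm (Fin α)) σ ∈ K α n :=
  mem_K_iff.2 fun j => by simp

theorem a_one_eq : (a 1 : MonoidAlgebra ℂ (S α n)) =
    (n.factorial : ℂ)⁻¹ • ∑ σ : Perm (Fin n), δ (sumCongr 1 σ) := rfl

theorem a_one_mul {x : MonoidAlgebra ℂ (S α n)} (hx : x ∈ biinvariant (K α n)) : a 1 * x = x := by
  have h := ((coeff_biinvariant_iff (K α n) x).1 hx).1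
  rw [a_one_eq, smul_mul_assoc, Finset.sum_mul, Finset.sum_congr rfl fun σ _ => h _ (mem_K_of σ),
    Finset.sum_const, Finset.card_univ, Fintype.card_perm, Fintype.card_fin,
    ← Nat.cast_smul_eq_nsmul ℂ, inv_smul_smul₀ (Nat.cast_ne_zero.2 n.factorial_ne_zero)]

theorem mul_a_one {x : MonoidAlgebra ℂ (S α n)} (hx : x ∈ biinvariant (K α n)) : x * a 1 = x := by
  have h := ((coeff_biinvariant_iff (K α n) x).1 hx).2
  rw [a_one_eq, mul_smul_comm, Finset.mul_sum, Finset.sum_congr rfl fun σ _ => h _ (mem_K_of σ),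
    Finset.sum_const, Finset.card_univ, Fintype.card_perm, Fintype.card_fin,
    ← Nat.cast_smul_eq_nsmul ℂ, inv_smul_smul₀ (Nat.cast_ne_zero.2 n.factorial_ne_zero)]

theorem δ_mul_a_one {k : S α n} (hk : k ∈ K α n) : δ k * a 1 = a 1 :=
  ((coeff_biinvariant_iff (K α n) _).1 (a_mem 1)).1 k hk

theorem commute_a_one {x : MonoidAlgebra ℂ (S α n)}
    (hx : ∀ σ : Perm (Fin n), δ (sumCongr 1 σ) * x = x * δ (sumCongr 1 σ)) :
    a 1 * x = x * a 1 := by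
  rw [a_one_eq, smul_mul_assoc, mul_smul_comm, Finset.sum_mul, Finset.mul_sum,
    Finset.sum_congr rfl fun σ _ => hx σ]

variable (α n) in
/-- The unital ring structure of the double coset algebra. -/
abbrev dcRing : Ring (DC α n) :=
  { (inferInstance : NonUnitalRing (DC α n)) with
    one := ⟨a 1, a_mem 1⟩
    one_mul := fun x => Subtype.ext (a_one_mul x.2)
    mul_one := fun x => Subtype.ext (mul_a_one x.2) }

attribute [local instance] dcRing

variable (α n) in
/-- The unital algebra structure of the double coset algebra. -/
abbrev dcAlgebra : Algebra ℂ (DC α n) := Algebra.ofModule smul_mul_assoc mul_smul_comm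

attribute [local instance] dcAlgebra

theorem coe_one : ((1 : DC α n) : MonoidAlgebra ℂ (S α n)) = a 1 := rfl

/-- A permutation of the first `α` letters as an element of the group algebra. -/
def emb (g : Perm (Fin α)) : MonoidAlgebra ℂ (S α n) := δ (sumCongr g 1)

theorem emb_mul (g g' : Perm (Fin α)) : (emb g * emb g' : MonoidAlgebra ℂ (S α n)) = emb (g * g') := by
  rw [emb, emb, δ_mul, Perm.sumCongr_mul, one_mul, emb]

theorem emb_one : (emb 1 : MonoidAlgebra ℂ (S α n)) = 1 := by
  exact congrArg δ Perm.sumCongr_one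

theorem a_one_mul_emb (g : Perm (Fin α)) : (a 1 * emb g : MonoidAlgebra ℂ (S α n)) = emb g * a 1 := by
  refine commute_a_one fun σ => ?_
  rw [emb, δ_mul, δ_mul, Perm.sumCongr_mul, Perm.sumCongr_mul, one_mul, mul_one, mul_one, one_mul]

theorem emb_mul_ind (g g' : Perm (Fin α)) (l : List (Fin α)) :
    (emb g * ind (restr g' l) : MonoidAlgebra ℂ (S α n)) = ind (restr (g * g') l) := by
  classical
  ext h
  have : typ ((sumCongr g (1 : Perm (Fin n)))⁻¹ * h) = restr g' l ↔ typ h = restr (g * g') l := by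
    rw [typ_eq_iff, typ_eq_iff]
    refine forall_congr' fun j => ?_
    rw [Perm.mul_apply, Perm.sumCongr_inv]
    by_cases hj : j ∈ l <;> rcases h (Sum.inl j) with i | y <;>
      simp [restr, hj, Equiv.symm_apply_eq]
  rw [coeff_ind, emb, MonoidAlgebra.coeff_single_mul_apply, coeff_ind, one_mul]
  simp only [this]

theorem a_eq_emb_mul (g : Perm (Fin α)) : (a g : MonoidAlgebra ℂ (S α n)) = emb g * a 1 := by
  rw [a_eq_ind, a_eq_ind, emb_mul_ind, mul_one]

/-- The sum of the transpositions of the letter `i` with the last `n` letters. -/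
def ψ (i : Fin α) : MonoidAlgebra ℂ (S α n) := ∑ y : Fin n, δ (swap (Sum.inl i) (Sum.inr y))

theorem δ_mul_ψ (g : Perm (Fin α)) (σ : Perm (Fin n)) (i : Fin α) :
    (δ (sumCongr g σ) * ψ i : MonoidAlgebra ℂ (S α n)) = ψ (g i) * δ (sumCongr g σ) := by
  rw [ψ, ψ, Finset.mul_sum, Finset.sum_mul]
  refine Fintype.sum_equiv σ _ _ fun y => ?_
  rw [δ_mul, δ_mul, mul_swap_eq_swap_mul]
  simp

theorem a_one_mul_ψ (i : Fin α) : (a 1 * ψ i : MonoidAlgebra ℂ (S α n)) = ψ i * a 1 :=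
  commute_a_one fun σ => by rw [δ_mul_ψ, Perm.one_apply]

-- The coefficient counts the new letters `y` for which `h (i y)` has the type of `restr 1 l`. This
-- forces `h y = i`, so there is at most one. Given the condition on the other letters, it exists
-- exactly when `h` does not fix `i`.
open Classical in
theorem coeff_ind_mul_ψ {i : Fin α} {l : List (Fin α)} (hi : i ∉ l) (h : S α n) :
    (ind (restr 1 l) * ψ i).coeff h =
      if (∀ j, j ≠ i → (h (Sum.inl j)).getLeft? = (restr 1 l).1 j) ∧ h (Sum.inl i) ≠ Sum.inl i
      then (n.factorial : ℂ)⁻¹ else 0 := by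
  have hy : ∀ y, typ (h * swap (Sum.inl i) (Sum.inr y)) = restr 1 l ↔
      (∀ j, j ≠ i → (h (Sum.inl j)).getLeft? = (restr 1 l).1 j) ∧ h (Sum.inr y) = Sum.inl i := by
    intro y
    rw [typ_eq_iff]
    constructor
    · intro H
      refine ⟨fun j hj => ?_, ?_⟩
      · simpa [swap_apply_of_ne_of_ne, hj] using H j
      · simpa [restr, hi, Sum.getLeft?_eq_some_iff] using H i
    · rintro ⟨H, H'⟩ j
      by_cases hj : j = i
      · subst hj; simp [H', restr, hi]
      · simpa [swap_apply_of_ne_of_ne, hj] using H j hj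
  rw [ψ, Finset.mul_sum, MonoidAlgebra.coeff_sum, Finsupp.finsetSum_apply]
  have : ∀ y : Fin n, (ind (restr 1 l) * δ (swap (Sum.inl i) (Sum.inr y))).coeff h =
      if (∀ j, j ≠ i → (h (Sum.inl j)).getLeft? = (restr 1 l).1 j) ∧ h (Sum.inr y) = Sum.inl i
      then (n.factorial : ℂ)⁻¹ else 0 := by
    intro y
    rw [MonoidAlgebra.coeff_mul_single_apply, coeff_ind, mul_one, swap_inv]
    simp only [hy]
  rw [Finset.sum_congr rfl fun y _ => this y]
  by_cases H : ∀ j, j ≠ i → (h (Sum.inl j)).getLeft? = (restr 1 l).1 j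
  · simp only [and_iff_right H]
    rcases hx : h.symm (Sum.inl i) with j | y
    · have hj : h (Sum.inl j) = Sum.inl i := by rw [← hx, apply_symm_apply]
      have hji : j = i := by
        by_contra hji
        have := H j hji
        rw [hj] at this
        simp only [restr, Perm.one_apply, Sum.getLeft?_inl] at this
        split_ifs at this
        exact hji (Option.some_injective _ this).symm
      rw [if_neg (by rw [hji] at hj; simp [hj])]
      refine Finset.sum_eq_zero fun y _ => if_neg fun hy => ?_
      cases h.injective (hj.trans hy.symm)
    · have hj : h (Sum.inr y) = Sum.inl i := by rw [← hx, apply_symm_apply]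
      rw [if_pos (fun hy => by cases h.injective (hj.trans hy.symm)), Finset.sum_eq_single y,
        if_pos hj]
      · intro y' _ hne
        exact if_neg fun hy => hne (Sum.inr_injective (h.injective (hy.trans hj.symm)))
      · simp
  · simp [H]

/-- The permutations counted on the left send `i` either to a new letter or, `i` itself being
excluded, to a letter `m` freed by `l`. This is the concrete form of the recursion defining `T`. -/
theorem ind_mul_ψ {i : Fin α} {l : List (Fin α)} (hi : i ∉ l) :
    (ind (restr 1 l) * ψ i : MonoidAlgebra ℂ (S α n)) =
      ind (restr 1 (i :: l)) + ∑ m ∈ l.toFinset, ind (restr (swap i m) l) := by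
  classical
  ext h
  rw [coeff_ind_mul_ψ hi, MonoidAlgebra.coeff_add, Finsupp.add_apply, MonoidAlgebra.coeff_sum,
    Finsupp.finsetSum_apply]
  simp only [coeff_ind]
  have h1 : typ h = restr 1 (i :: l) ↔
      (∀ j, j ≠ i → (h (Sum.inl j)).getLeft? = (restr 1 l).1 j) ∧
        (h (Sum.inl i)).getLeft? = none := by
    rw [typ_eq_iff]
    constructor
    · intro H
      exact ⟨fun j hj => by simpa [restr, hj] using H j, by simpa [restr] using H i⟩
    · rintro ⟨H, H'⟩ j
      by_cases hj : j = i
      · subst hj; simpa [restr] using H'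
      · simpa [restr, hj] using H j hj
  have h2 : ∀ m ∈ l.toFinset, (typ h = restr (swap i m) l ↔
      (∀ j, j ≠ i → (h (Sum.inl j)).getLeft? = (restr 1 l).1 j) ∧ h (Sum.inl i) = Sum.inl m) := by
    intro m hm
    have hm : m ∈ l := by simpa using hm
    rw [typ_eq_iff]
    have hs : ∀ j, j ≠ i → (restr (swap i m) l).1 j = (restr 1 l).1 j := by
      intro j hj
      by_cases hjl : j ∈ l
      · simp [restr, hjl]
      · have : j ≠ m := fun h => hjl (h ▸ hm)
        simp [restr, hjl, swap_apply_of_ne_of_ne hj this]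
    constructor
    · intro H
      exact ⟨fun j hj => by rw [H, hs j hj],
        by simpa [restr, hi, Sum.getLeft?_eq_some_iff] using H i⟩
    · rintro ⟨H, H'⟩ j
      by_cases hj : j = i
      · subst hj; simp [restr, H', hi]
      · rw [hs j hj, H j hj]
  rw [Finset.sum_congr rfl fun m hm => if_congr (h2 m hm) rfl rfl]
  simp only [h1]
  by_cases H : ∀ j, j ≠ i → (h (Sum.inl j)).getLeft? = (restr 1 l).1 j
  · simp only [and_iff_right H]
    rcases hx : h (Sum.inl i) with m | y
    · simp only [Sum.inl.injEq, Sum.getLeft?_inl, reduceCtorEq, if_false, zero_add]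
      by_cases hmi : m = i
      · rw [if_neg (by simp [hmi]), Finset.sum_eq_zero]
        intro m' hm'
        rw [if_neg]
        rintro rfl
        exact hi (by simpa [hmi] using hm')
      · have hm : m ∈ l := by
          by_contra hm
          have := H m hmi
          simp only [restr, hm, if_false, Perm.one_apply, Sum.getLeft?_eq_some_iff] at this
          exact hmi (Sum.inl_injective (h.injective (this.trans hx.symm)))
        rw [if_pos fun hh => hmi (Sum.inl_injective hh), Finset.sum_ite_eq, if_pos (by simpa using hm)]
    · simp
  · simp [H]

theorem θ_eq_a_one_mul (i : Fin α) : (θ i : MonoidAlgebra ℂ (S α n)) = a 1 * ψ i := by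
  rw [θ_eq_ind, a_eq_ind, ind_mul_ψ List.not_mem_nil]
  simp

theorem θ_eq (i : Fin α) : (θ i : MonoidAlgebra ℂ (S α n)) = ψ i * a 1 := by
  rw [θ_eq_a_one_mul, a_one_mul_ψ]

/-- The idempotent `a 1` can be pushed to the right end of every product, so relations need only be
verified in the group algebra up to a right factor `a 1`. -/
theorem mul_a_one_mul_mul_a_one (x : MonoidAlgebra ℂ (S α n)) {y : MonoidAlgebra ℂ (S α n)}
    (hy : a 1 * y = y * a 1) : x * a 1 * (y * a 1) = x * y * a 1 := by
  rw [mul_assoc, ← hy, ← mul_assoc (a 1), a_one_mul (a_mem 1), hy, mul_assoc]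

/-- For `y ≠ z`, `(j y)(j z) = (j z)(y z)` and `a 1` absorbs `(y z)`. Each `(j z)` thus arises n - 1
times, and the n diagonal terms are squares equal to 1. -/
theorem ψ_mul_ψ_self (j : Fin α) : (ψ j * ψ j * a 1 : MonoidAlgebra ℂ (S α n)) =
    ((n : ℂ) - 1) • (ψ j * a 1) + (n : ℂ) • a 1 := by
  have key : ∀ y z : Fin n, (δ (swap (Sum.inl j) (Sum.inr y)) * δ (swap (Sum.inl j) (Sum.inr z)) * a 1 :
      MonoidAlgebra ℂ (S α n)) =
      δ (swap (Sum.inl j) (Sum.inr z)) * a 1 + if z = y then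
        a 1 - δ (swap (Sum.inl j) (Sum.inr z)) * a 1 else 0 := by
    intro y z
    split_ifs with h
    · rw [h, δ_mul, swap_mul_self, δ_one, one_mul]; abel
    · rw [add_zero]
      have hk : swap (Sum.inr y) (Sum.inr z) ∈ K α n := mem_K_iff.2 fun j => by
        rw [swap_apply_of_ne_of_ne] <;> simp
      have : swap (Sum.inl j) (Sum.inr y) * swap (Sum.inl j) (Sum.inr z) =
          swap (Sum.inl j) (Sum.inr z) * (swap (Sum.inr y) (Sum.inr z) : S α n) := by
        have : (Sum.inr y : Fin α ⊕ Fin n) ≠ Sum.inr z := fun hh => h (Sum.inr_injective hh).symm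
        ext1 x; simp only [Perm.mul_apply, swap_apply_def]; grind
      rw [δ_mul, this, ← δ_mul, mul_assoc, δ_mul_a_one hk]
  rw [ψ, Finset.sum_mul_sum]
  simp only [Finset.sum_mul, key, Finset.sum_add_distrib, Finset.sum_ite_eq',
    Finset.mem_univ, if_true, Finset.sum_sub_distrib, Finset.sum_const, Finset.card_univ,
    Fintype.card_fin, ← Nat.cast_smul_eq_nsmul ℂ, sub_smul, one_smul]
  abel

/-- Only the diagonal terms survive, through `(j y)(i y) = (i j)(j y)` and `(i y)(j y) = (i j)(i
y)`. -/
theorem ψ_comm {i j : Fin α} (hij : i ≠ j) : (ψ j * ψ i - ψ i * ψ j : MonoidAlgebra ℂ (S α n)) =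
    emb (swap i j) * (ψ j - ψ i) := by
  have hs : sumCongr (swap i j) (1 : Perm (Fin n)) = swap (Sum.inl i) (Sum.inl j) :=
    Perm.sumCongr_swap_one i j
  rw [emb, hs, ψ, ψ, Finset.sum_mul_sum, Finset.sum_mul_sum,
    Finset.sum_comm (f := fun a b => δ (swap (Sum.inl i) (Sum.inr a)) * _),
    ← Finset.sum_sub_distrib, ← Finset.sum_sub_distrib, Finset.mul_sum]
  refine Finset.sum_congr rfl fun y _ => ?_
  have hij' : (Sum.inl i : Fin α ⊕ Fin n) ≠ Sum.inl j := fun h => hij (Sum.inl_injective h)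
  rw [← Finset.sum_sub_distrib, Finset.sum_eq_single y]
  · simp only [mul_sub, δ_mul]
    congr 2
    · ext1 x; simp only [Perm.mul_apply, swap_apply_def]; grind
    · ext1 x; simp only [Perm.mul_apply, swap_apply_def]; grind
  · intro z _ hzy
    have : (Sum.inr z : Fin α ⊕ Fin n) ≠ Sum.inr y := fun h => hzy (Sum.inr_injective h)
    rw [δ_mul, δ_mul, sub_eq_zero]
    congr 1
    ext1 x; simp only [Perm.mul_apply, swap_apply_def]; grind
  · simp

/-- Off the diagonal, left multiplication by `(i j)` amounts to right multiplication by `(y z)`,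
which `a 1` absorbs, so these terms vanish. The diagonal terms cancel the part linear in `ψ j`. -/
theorem emb_swap_mul_ψ_mul_ψ {i j : Fin α} (hij : i ≠ j) :
    ((emb (swap i j) - 1) * ψ j * (ψ i + 1) * a 1 : MonoidAlgebra ℂ (S α n)) = 0 := by
  have hs : sumCongr (swap i j) (1 : Perm (Fin n)) = swap (Sum.inl i) (Sum.inl j) :=
    Perm.sumCongr_swap_one i j
  have hij' : (Sum.inl i : Fin α ⊕ Fin n) ≠ Sum.inl j := fun h => hij (Sum.inl_injective h)
  have key : ∀ y z : Fin n, ((emb (swap i j) - 1) *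
      (δ (swap (Sum.inl j) (Sum.inr y)) * δ (swap (Sum.inl i) (Sum.inr z))) * a 1 :
        MonoidAlgebra ℂ (S α n)) =
      if z = y then (1 - emb (swap i j)) * δ (swap (Sum.inl j) (Sum.inr y)) * a 1 else 0 := by
    intro y z
    split_ifs with h
    · rw [h, δ_mul]
      simp only [sub_mul, emb, hs, δ_mul, one_mul]
      congr 3
      · ext1 x; simp only [Perm.mul_apply, swap_apply_def]; grind
      · ext1 x; simp only [Perm.mul_apply, swap_apply_def]; grind
    · have hyz : (Sum.inr y : Fin α ⊕ Fin n) ≠ Sum.inr z := fun hh => h (Sum.inr_injective hh).symm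
      have hk : swap (Sum.inr y) (Sum.inr z) ∈ K α n := mem_K_iff.2 fun j => by
        rw [swap_apply_of_ne_of_ne] <;> simp
      have : swap (Sum.inl i) (Sum.inl j) *
          (swap (Sum.inl j) (Sum.inr y) * swap (Sum.inl i) (Sum.inr z)) =
          swap (Sum.inl j) (Sum.inr y) * swap (Sum.inl i) (Sum.inr z) *
            (swap (Sum.inr y) (Sum.inr z) : S α n) := by
        ext1 x; simp only [Perm.mul_apply, swap_apply_def]; grind
      rw [sub_mul, sub_mul, emb, hs, δ_mul, δ_mul, this, ← δ_mul, mul_assoc, δ_mul_a_one hk,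
        one_mul, sub_self]
  have h2 : ((emb (swap i j) - 1) * (ψ j * ψ i) * a 1 : MonoidAlgebra ℂ (S α n)) =
      (1 - emb (swap i j)) * ψ j * a 1 := by
    rw [ψ, ψ, Finset.sum_mul_sum]
    simp only [Finset.mul_sum, Finset.sum_mul, key, Finset.sum_ite_eq',
      Finset.mem_univ, if_true]
  rw [mul_add, mul_one, add_mul, mul_assoc (emb _ - 1), h2, ← add_mul, ← add_mul]
  simp

variable (α n) in
/-- The realization of `O[α;n]` in the double coset algebra. -/
def dcRealization : Realization α (DC α n) where
  z := algebraMap ℂ _ (n : ℂ)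
  A g := ⟨a g, a_mem g⟩
  Θ i := ⟨θ i, θ_mem i⟩
  z_comm := Algebra.commutes _
  A_one := rfl
  A_mul g₁ g₂ := Subtype.ext <| by
    change a g₁ * a g₂ = a (g₁ * g₂)
    rw [a_eq_emb_mul g₁, a_eq_emb_mul g₂, mul_a_one_mul_mul_a_one _ (a_one_mul_emb _), emb_mul,
      ← a_eq_emb_mul]
  conj g i := Subtype.ext <| by
    change a g * θ i * a g⁻¹ = θ (g i)
    rw [a_eq_emb_mul g, a_eq_emb_mul g⁻¹, θ_eq, θ_eq, mul_a_one_mul_mul_a_one _ (a_one_mul_ψ _),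
      mul_a_one_mul_mul_a_one _ (a_one_mul_emb _), emb, δ_mul_ψ, ← emb, mul_assoc (ψ _), emb_mul,
      mul_inv_cancel, emb_one, mul_one]
  sq j := Subtype.ext <| by
    rw [sub_mul, one_mul, ← Algebra.smul_def, Algebra.algebraMap_eq_smul_one]
    change θ j * θ j = (n : ℂ) • θ j - θ j + (n : ℂ) • a 1
    rw [θ_eq, mul_a_one_mul_mul_a_one _ (a_one_mul_ψ _), ψ_mul_ψ_self, sub_smul, one_smul]
  comm i j h := Subtype.ext <| by
    change θ j * θ i - θ i * θ j = a (swap i j) * (θ j - θ i)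
    rw [a_eq_emb_mul, θ_eq, θ_eq, mul_a_one_mul_mul_a_one _ (a_one_mul_ψ _),
      mul_a_one_mul_mul_a_one _ (a_one_mul_ψ _), ← sub_mul, ← sub_mul, ψ_comm h,
      mul_a_one_mul_mul_a_one _ (by rw [mul_sub, sub_mul, a_one_mul_ψ, a_one_mul_ψ])]
  swap_mul i j h := Subtype.ext <| by
    change (a (swap i j) - a 1) * θ j * (θ i + a 1) = 0
    have : ψ i * a 1 + a 1 = (ψ i + 1) * (a 1 : MonoidAlgebra ℂ (S α n)) := by rw [add_mul, one_mul]
    rw [a_eq_emb_mul (swap i j), θ_eq, θ_eq, this, ← sub_one_mul,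
      mul_a_one_mul_mul_a_one _ (a_one_mul_ψ _),
      mul_a_one_mul_mul_a_one _ (by rw [mul_add, add_mul, a_one_mul_ψ, one_mul, mul_one]),
      emb_swap_mul_ψ_mul_ψ h]

theorem coe_T {l : List (Fin α)} (hl : l.Nodup) :
    ((dcRealization α n).T l : MonoidAlgebra ℂ (S α n)) = ind (restr 1 l) := by
  induction l with
  | nil => rw [Realization.T_nil, coe_one, a_eq_ind]
  | cons i l ih =>
    have ih := ih hl.of_cons
    have hi := (List.nodup_cons.1 hl).1
    have h1 : ((dcRealization α n).T (i :: l) : MonoidAlgebra ℂ (S α n)) =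
        ind (restr 1 l) * θ i - ∑ m ∈ l.toFinset, a (swap i m) * ind (restr 1 l) := by
      rw [Realization.T_cons, Realization.jm, Finset.sum_mul, NonUnitalSubalgebra.coe_sub,
        NonUnitalSubalgebra.coe_mul, ih]
      congr 1
      rw [AddSubmonoidClass.coe_finsetSum]
      refine Finset.sum_congr rfl fun m _ => ?_
      rw [NonUnitalSubalgebra.coe_mul, ih]
      rfl
    rw [h1, θ_eq_a_one_mul, ← mul_assoc, mul_a_one (ind_mem _), ind_mul_ψ hi]
    have h2 : ∀ m, (a (swap i m) * ind (restr 1 l) : MonoidAlgebra ℂ (S α n)) =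
        ind (restr (swap i m) l) := fun m => by
      rw [a_eq_emb_mul, mul_assoc, a_one_mul (ind_mem _), emb_mul_ind, mul_one]
    simp only [h2, add_sub_cancel_right]

theorem coe_e (p : PB α) :
    ((dcRealization α n).e p : MonoidAlgebra ℂ (S α n)) = ind p := by
  rw [Realization.e, NonUnitalSubalgebra.coe_mul, coe_T (nodup_listOf p)]
  change a (permOf p) * _ = _
  rw [a_eq_emb_mul, mul_assoc, a_one_mul (ind_mem _), emb_mul_ind, mul_one, restr_permOf_listOf]

end

/-! ### The canonical homomorphism and semisimplicity at integers n ≥ α -/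

section

open Equiv Polynomial

variable {α n : ℕ}

attribute [local instance] dcRing dcAlgebra

theorem dcRealization_z : (dcRealization α n).z = algebraMap ℂ (DC α n) (n : ℂ) := rfl

variable (α n) in
/-- The canonical homomorphism. -/
def canonical : O α (n : ℂ) →ₐ[ℂ] DC α n := (dcRealization α n).lift dcRealization_z

theorem coe_canonical_e (p : PB α) :
    (canonical α n ((tautological α n).e p) : MonoidAlgebra ℂ (S α n)) = ind p := by
  rw [canonical, Realization.lift_e, coe_e]

theorem isCanonical_canonical : IsCanonical (canonical α n : O α (n : ℂ) →ₙₐ[ℂ] DC α n) := by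
  constructor
  · intro g
    change ((canonical α n (A g) : DC α n) : MonoidAlgebra ℂ (S α n)) = a g
    rw [canonical, Realization.lift_A]; rfl
  · intro i
    change ((canonical α n (Θ i) : DC α n) : MonoidAlgebra ℂ (S α n)) = θ i
    rw [canonical, Realization.lift_Θ]; rfl

theorem IsCanonical.eq {φ φ' : O α (n : ℂ) →ₙₐ[ℂ] DC α n} (h : IsCanonical φ)
    (h' : IsCanonical φ') : φ = φ' := by
  have hA : ∀ g, φ (A g) = φ' (A g) := fun g => Subtype.ext ((h.1 g).trans (h'.1 g).symm)
  ext1 x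
  induction x using O_induction with
  -- The homomorphisms are not assumed unital; the value at 1 is fixed because `1 = A 1`.
  | hc c => rw [Algebra.algebraMap_eq_smul_one, map_smul, map_smul, ← A_one, hA]
  | hA g => exact hA g
  | hΘ i => exact Subtype.ext ((h.2 i).trans (h'.2 i).symm)
  | hadd x y hx hy => rw [map_add, map_add, hx, hy]
  | hmul x y hx hy => rw [map_mul, map_mul, hx, hy]

theorem coeff_sum_ind (c : PB α → ℂ) (h : S α n) :
    (∑ p, c p • (ind p : MonoidAlgebra ℂ (S α n))).coeff h =
      c (typ h) * (n.factorial : ℂ)⁻¹ := by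
  classical
  rw [MonoidAlgebra.coeff_sum, Finsupp.finsetSum_apply]
  simp [coeff_ind]

theorem coe_canonical_sum (c : PB α → ℂ) :
    (canonical α n (∑ p, c p • (tautological α n).e p) : MonoidAlgebra ℂ (S α n)) =
      ∑ p, c p • ind p := by
  rw [map_sum, AddSubmonoidClass.coe_finsetSum]
  refine Finset.sum_congr rfl fun p _ => ?_
  rw [map_smul, NonUnitalSubalgebra.coe_smul, coe_canonical_e]

/-- A biinvariant function is a combination of indicators of double cosets, with its value at any
representative (times n!) as coefficient. Types that do not occur receive coefficient 0, so no bound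
on n is needed. -/
theorem canonical_surjective : Function.Surjective (canonical α n) := by
  classical
  intro f
  refine ⟨∑ p, (if h : ∃ h : S α n, typ h = p then
    n.factorial * (f : MonoidAlgebra ℂ (S α n)).coeff h.choose else 0) • (tautological α n).e p, ?_⟩
  refine Subtype.ext ?_
  rw [coe_canonical_sum]
  ext h
  have hex : ∃ h' : S α n, typ h' = typ h := ⟨h, rfl⟩
  rw [coeff_sum_ind, dif_pos hex, mul_comm, inv_mul_cancel_left₀
    (Nat.cast_ne_zero.2 n.factorial_ne_zero)]
  obtain ⟨k, hk, k', hk', he⟩ := exists_eq_of_typ_eq hex.choose_spec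
  rw [← f.2 k hk k' hk', ← he]

/-- The images `ind p` have pairwise disjoint supports, all nonempty since every type occurs. -/
theorem linearIndependent_e_of_le (hn : α ≤ n) : LinearIndependent ℂ (tautological α n).e := by
  rw [Fintype.linearIndependent_iff]
  intro c hc p
  have h := coe_canonical_sum (n := n) c
  obtain ⟨g, rfl⟩ := exists_typ_eq hn p
  rw [hc, map_zero] at h
  have h2 := coeff_sum_ind (n := n) c g
  rw [← h] at h2
  have h3 : c (typ g) * (n.factorial : ℂ)⁻¹ = 0 := h2.symm
  exact (mul_eq_zero.1 h3).resolve_right (inv_ne_zero (Nat.cast_ne_zero.2 n.factorial_ne_zero))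

theorem canonical_injective (hn : α ≤ n) : Function.Injective (canonical α n) := by
  rw [injective_iff_map_eq_zero]
  intro x hx
  have hx' : x ∈ (tautological α (n : ℂ)).comb.range := by
    rw [range_comb_tautological]; trivial
  obtain ⟨c, rfl⟩ := hx'
  rw [comb_tautological] at hx ⊢
  have h := coe_canonical_sum (n := n) fun p => (c p).eval (n : ℂ)
  rw [hx] at h
  refine Finset.sum_eq_zero fun p _ => ?_
  obtain ⟨g, rfl⟩ := exists_typ_eq hn p
  have h2 := coeff_sum_ind (n := n) (fun p => (c p).eval (n : ℂ)) g
  rw [← h] at h2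
  have h3 := (mul_eq_zero.1 h2.symm).resolve_right
    (inv_ne_zero (Nat.cast_ne_zero.2 n.factorial_ne_zero))
  rw [h3, zero_smul]

/-- Semisimplicity of the double coset algebra: there is no nonzero nil right ideal of bounded
index. -/
theorem eq_zero_of_forall_pow_eq_zero (hn : α ≤ n) (N : ℕ) {x : O α (n : ℂ)}
    (h : ∀ y, (x * y) ^ N = 0) : x = 0 := by
  -- The image of `x` lies in the radical of the whole group algebra, which is zero by Maschke's
  -- theorem. It suffices that `w * f` is nilpotent for every `w`, not just for biinvariant `w`.
  have hJ : ((canonical α n x : DC α n) : MonoidAlgebra ℂ (S α n)) ∈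
      Ideal.jacobson (⊥ : Ideal (MonoidAlgebra ℂ (S α n))) := by
    set f : DC α n := canonical α n x with hf
    rw [Ideal.mem_jacobson_iff]
    intro w
    have hw : a 1 * w * a 1 ∈ biinvariant (K α n) := by
      rw [← SetLike.mem_coe]
      refine (coeff_biinvariant_iff (K α n) _).2 ⟨fun k hk => ?_, fun k hk => ?_⟩
      · rw [← mul_assoc, ← mul_assoc,
          ((coeff_biinvariant_iff (K α n) _).1 (a_mem 1)).1 k hk]
      · rw [mul_assoc, ((coeff_biinvariant_iff (K α n) _).1 (a_mem 1)).2 k hk]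
    obtain ⟨y, hy⟩ := canonical_surjective (α := α) (n := n) ⟨_, hw⟩
    have hfy : (f * ⟨_, hw⟩) ^ N = 0 := by
      rw [← hy, hf, ← map_mul, ← map_pow, h, map_zero]
    -- Since `f` absorbs `a 1` on both sides, `w` may be replaced by its biinvariant compression `a
    -- 1 * w * a 1`, to which the hypothesis applies.
    have hpow : ∀ m : ℕ, ((((f * ⟨_, hw⟩) ^ m * f : DC α n)) : MonoidAlgebra ℂ (S α n)) =
        f * (w * f) ^ m := by
      intro m
      induction m with
      | zero => simp
      | succ m ih =>
        rw [pow_succ', mul_assoc, NonUnitalSubalgebra.coe_mul, ih, NonUnitalSubalgebra.coe_mul,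
          pow_succ']
        simp only [← mul_assoc]
        rw [mul_a_one f.2, mul_assoc _ (a 1), a_one_mul f.2]
    have hnil : IsNilpotent (w * f) := by
      refine ⟨N + 1, ?_⟩
      rw [pow_succ', mul_assoc, ← hpow, hfy, zero_mul]
      exact mul_zero _
    obtain ⟨u, hu⟩ := hnil.isUnit_add_one
    refine ⟨↑u⁻¹, ?_⟩
    have : (↑u⁻¹ * w * f + ↑u⁻¹ - 1 : MonoidAlgebra ℂ (S α n)) = 0 := by
      rw [mul_assoc, ← mul_add_one, ← hu, Units.inv_mul, sub_self]
    rw [this]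
    exact zero_mem _
  have hbot : Ideal.jacobson (⊥ : Ideal (MonoidAlgebra ℂ (S α n))) = ⊥ := by
    have : NeZero (Nat.card (S α n) : ℂ) := ⟨Nat.cast_ne_zero.2 Nat.card_pos.ne'⟩
    rw [Ideal.jacobson_bot]
    exact IsSemisimpleModule.jacobson_eq_bot _ _
  rw [hbot, Ideal.mem_bot] at hJ
  refine canonical_injective hn ?_
  rw [map_zero]
  exact Subtype.ext hJ

end

/-! ### Polynomial dependence on ν, the generic realization and the dimension -/

section

open Equiv Polynomial

variable {α n : ℕ}

variable (α) in
/-- The realization in the product of all algebras `O[α;ν]`. -/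
def piRealization : Realization α (∀ ν, O α ν) where
  z ν := (tautological α ν).z
  A g _ := A g
  Θ i _ := Θ i
  z_comm x := funext fun ν => (tautological α ν).z_comm (x ν)
  A_one := funext fun ν => (tautological α ν).A_one
  A_mul g₁ g₂ := funext fun ν => (tautological α ν).A_mul g₁ g₂
  conj g i := funext fun ν => (tautological α ν).conj g i
  sq j := funext fun ν => (tautological α ν).sq j
  comm i j h := funext fun ν => (tautological α ν).comm i j h
  swap_mul i j h := funext fun ν => (tautological α ν).swap_mul i j h

theorem piRealization_e (p : PB α) (ν : ℂ) : (piRealization α).e p ν = (tautological α ν).e p :=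
  (piRealization α).map_e (tautological α ν) (Pi.evalRingHom _ ν) (fun _ => rfl) (fun _ => rfl) p

theorem piRealization_comb (c : PB α → ℂ[X]) (ν : ℂ) :
    (piRealization α).comb c ν = ∑ q, (c q).eval ν • (tautological α ν).e q := by
  rw [← comb_tautological, Realization.comb_apply, Realization.comb_apply, Finset.sum_apply]
  refine Finset.sum_congr rfl fun q _ => ?_
  rw [Pi.mul_apply, piRealization_e]
  congr 1
  exact (aeval_algHom_apply (Pi.evalAlgHom ℂ (fun ν => O α ν) ν) (piRealization α).z (c q)).symm

/-- Working in the product over all ν, where `z` has component ν at ν, yields one set of polynomial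
coefficients valid for all ν at once. -/
theorem exists_matrix_A (g : Perm (Fin α)) : ∃ M : Matrix (PB α) (PB α) ℂ[X],
    ∀ ν p, (tautological α ν).e p * A g = ∑ q, (M p q).eval ν • (tautological α ν).e q := by
  choose M hM using fun p => (piRealization α).mul_A_mem ((piRealization α).e_mem p) g
  refine ⟨M, fun ν p => ?_⟩
  rw [← piRealization_comb, hM, Pi.mul_apply, piRealization_e]
  rfl

theorem exists_matrix_Θ (i : Fin α) : ∃ M : Matrix (PB α) (PB α) ℂ[X],
    ∀ ν p, (tautological α ν).e p * Θ i = ∑ q, (M p q).eval ν • (tautological α ν).e q := by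
  choose M hM using fun p => (piRealization α).mul_Θ_mem ((piRealization α).e_mem p) i
  refine ⟨M, fun ν p => ?_⟩
  rw [← piRealization_comb, hM, Pi.mul_apply, piRealization_e]
  rfl

/-- `N` is the matrix of the right multiplication by `x`. -/
def Represents {ν : ℂ} (N : Matrix (PB α) (PB α) ℂ) (x : O α ν) : Prop :=
  ∀ p, (tautological α ν).e p * x = ∑ q, N p q • (tautological α ν).e q

namespace Represents

variable {ν : ℂ} {N N' : Matrix (PB α) (PB α) ℂ} {x x' : O α ν}

theorem add (h : Represents N x) (h' : Represents N' x') : Represents (N + N') (x + x') := by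
  intro p
  simp only [mul_add, h p, h' p, Matrix.add_apply, add_smul, Finset.sum_add_distrib]

theorem sub (h : Represents N x) (h' : Represents N' x') : Represents (N - N') (x - x') := by
  intro p
  rw [mul_sub, h p, h' p, ← Finset.sum_sub_distrib]
  exact Finset.sum_congr rfl fun q _ => (sub_smul (N p q) (N' p q) ((tautological α ν).e q)).symm

/-- Right multiplication, with rows indexed by the multiplied element, keeps the order of factors,
so the matrices give a representation and not an antirepresentation. -/
theorem mul (h : Represents N x) (h' : Represents N' x') : Represents (N * N') (x * x') := by
  intro p
  rw [← mul_assoc, h p, Finset.sum_mul]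
  simp only [smul_mul_assoc, h' _, Finset.smul_sum, smul_smul, Matrix.mul_apply, Finset.sum_smul]
  exact Finset.sum_comm

variable (ν) in
theorem algebraMap (c : ℂ) : Represents (α := α) (algebraMap ℂ _ c) (algebraMap ℂ (O α ν) c) := by
  classical
  intro p
  simp [Matrix.algebraMap_matrix_apply, ← Algebra.commutes, ← Algebra.smul_def]

variable (α ν) in
theorem one : Represents (1 : Matrix (PB α) (PB α) ℂ) (1 : O α ν) := by
  simpa using algebraMap (α := α) ν 1

variable (α ν) in
theorem zero : Represents (0 : Matrix (PB α) (PB α) ℂ) (0 : O α ν) := by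
  simpa using algebraMap (α := α) ν 0

theorem unique (hn : α ≤ n) {x : O α (n : ℂ)} (h : Represents N x) (h' : Represents N' x) :
    N = N' := by
  ext p q
  have hli := Fintype.linearIndependent_iff.1 (linearIndependent_e_of_le (α := α) hn)
    (fun q => N p q - N' p q)
  refine sub_eq_zero.1 (hli ?_ q)
  simp only [sub_smul, Finset.sum_sub_distrib, ← h p, ← h' p, sub_self]

end Represents

/-- Evaluation of polynomial matrices. -/
def ev (α : ℕ) (ν : ℂ) : Matrix (PB α) (PB α) ℂ[X] →+* Matrix (PB α) (PB α) ℂ :=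
  (evalRingHom ν).mapMatrix

theorem ev_apply (ν : ℂ) (M : Matrix (PB α) (PB α) ℂ[X]) (p q : PB α) :
    ev α ν M p q = (M p q).eval ν := rfl

/-- Polynomials that agree at infinitely many points are equal. Independence of the `e p`, known so
far only at integers n ≥ α, is therefore enough to prove identities for all ν. -/
theorem ext_of_ev {M M' : Matrix (PB α) (PB α) ℂ[X]}
    (h : ∀ n : ℕ, α ≤ n → ev α n M = ev α n M') : M = M' := by
  ext1 p q
  refine eq_of_infinite_eval_eq _ _ (((Set.Ici_infinite α).image
    (Nat.cast_injective (R := ℂ)).injOn).mono ?_)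
  rintro _ ⟨n, hn, rfl⟩
  exact congrFun (congrFun (h n hn) p) q

/-- A polynomial matrix whose values represent the right multiplication by `A(g)`. -/
def matA (g : Perm (Fin α)) : Matrix (PB α) (PB α) ℂ[X] := (exists_matrix_A g).choose

/-- A polynomial matrix whose values represent the right multiplication by `Θ_i`. -/
def matΘ (i : Fin α) : Matrix (PB α) (PB α) ℂ[X] := (exists_matrix_Θ i).choose

theorem represents_matA (ν : ℂ) (g : Perm (Fin α)) : Represents (ev α ν (matA g)) (A g : O α ν) :=
  fun p => (exists_matrix_A g).choose_spec ν p

theorem represents_matΘ (ν : ℂ) (i : Fin α) : Represents (ev α ν (matΘ i)) (Θ i : O α ν) :=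
  fun p => (exists_matrix_Θ i).choose_spec ν p

theorem ev_algebraMap_X (ν : ℂ) : ev α ν (algebraMap ℂ[X] _ X) = algebraMap ℂ _ ν := by
  classical
  ext p q
  simp only [ev_apply, Matrix.algebraMap_matrix_apply]
  split_ifs <;> simp

theorem eq_of_represents {M M' : Matrix (PB α) (PB α) ℂ[X]} (x : ∀ ν, O α ν)
    (h : ∀ ν, Represents (ev α ν M) (x ν)) (h' : ∀ ν, Represents (ev α ν M') (x ν)) : M = M' :=
  ext_of_ev fun n hn => (h n).unique hn (h' n)

variable (α) in
/-- The generic realization, by the matrices of right multiplications. -/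
def generic : Realization α (Matrix (PB α) (PB α) ℂ[X]) where
  z := algebraMap ℂ[X] _ X
  A := matA
  Θ := matΘ
  z_comm := Algebra.commutes _
  A_one := eq_of_represents (fun ν => A 1) (fun ν => represents_matA ν 1) fun ν => by
    rw [map_one, A_one]; exact Represents.one α ν
  A_mul g₁ g₂ := eq_of_represents (fun ν => A (g₁ * g₂)) (fun ν => by
    rw [map_mul, ← tautological_A, ← (tautological α ν).A_mul]
    exact (represents_matA ν g₁).mul (represents_matA ν g₂)) fun ν => represents_matA ν _
  conj g i := eq_of_represents (fun ν => Θ (g i)) (fun ν => by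
    rw [map_mul, map_mul, ← tautological_Θ, ← (tautological α ν).conj]
    exact ((represents_matA ν g).mul (represents_matΘ ν i)).mul (represents_matA ν g⁻¹))
    fun ν => represents_matΘ ν _
  sq j := eq_of_represents (fun ν => Θ j * Θ j) (fun ν => by
    rw [map_mul]
    exact (represents_matΘ ν j).mul (represents_matΘ ν j)) fun ν => by
      rw [map_add, map_mul, map_sub, ev_algebraMap_X, map_one, ← tautological_Θ,
        (tautological α ν).sq]
      exact (((Represents.algebraMap ν ν).sub (Represents.one α ν)).mul
        (represents_matΘ ν j)).add (Represents.algebraMap ν ν)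
  comm i j h := eq_of_represents (fun ν => Θ j * Θ i - Θ i * Θ j) (fun ν => by
    rw [map_sub, map_mul, map_mul]
    exact ((represents_matΘ ν j).mul (represents_matΘ ν i)).sub
      ((represents_matΘ ν i).mul (represents_matΘ ν j))) fun ν => by
      have := (tautological α ν).comm i j h
      simp only [tautological_Θ, tautological_A] at this
      rw [map_mul, map_sub, this]
      exact (represents_matA ν _).mul ((represents_matΘ ν j).sub (represents_matΘ ν i))
  swap_mul i j h := eq_of_represents (fun ν => 0) (fun ν => by
    have := (tautological α ν).swap_mul i j h
    simp only [tautological_Θ, tautological_A] at this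
    rw [map_mul, map_mul, map_sub, map_add, map_one, ← this]
    exact (((represents_matA ν _).sub (Represents.one α ν)).mul (represents_matΘ ν j)).mul
      ((represents_matΘ ν i).add (Represents.one α ν))) fun ν => by
    rw [map_zero]; exact Represents.zero α ν

/-- The generic realization over a commutative ring `k` with a chosen value of the parameter. -/
def genericMap {k : Type*} [CommRing k] (χ : ℂ[X] →+* k) : Realization α (Matrix (PB α) (PB α) k) :=
  (generic α).map χ.mapMatrix fun x => by
    have : χ.mapMatrix (generic α).z = algebraMap k (Matrix (PB α) (PB α) k) (χ X) := by
      classical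
      ext p q
      simp only [generic, RingHom.mapMatrix_apply, Matrix.map_apply,
        Matrix.algebraMap_matrix_apply]
      split_ifs <;> simp
    rw [this]
    exact Algebra.commutes _ _

theorem genericMap_e {k : Type*} [CommRing k] (χ : ℂ[X] →+* k) (p : PB α) :
    (genericMap χ).e p = ((generic α).e p).map χ :=
  ((generic α).map_e (genericMap χ) χ.mapMatrix (fun _ => rfl) (fun _ => rfl) p).symm

theorem genericMap_eval_z (ν : ℂ) :
    (genericMap (α := α) (evalRingHom ν)).z = algebraMap ℂ _ ν := ev_algebraMap_X ν

variable (α) in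
/-- The right regular representation of `O[α;ν]`. -/
def rep (ν : ℂ) : O α ν →ₐ[ℂ] Matrix (PB α) (PB α) ℂ :=
  (genericMap (evalRingHom ν)).lift (genericMap_eval_z ν)

theorem represents_rep {ν : ℂ} (x : O α ν) : Represents (rep α ν x) x := by
  induction x using O_induction with
  | hc c => rw [AlgHom.commutes]; exact Represents.algebraMap ν c
  | hA g => rw [rep, Realization.lift_A]; exact represents_matA ν g
  | hΘ i => rw [rep, Realization.lift_Θ]; exact represents_matΘ ν i
  | hadd x y hx hy => rw [map_add]; exact hx.add hy
  | hmul x y hx hy => rw [map_mul]; exact hx.mul hy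

theorem rep_e (ν : ℂ) (p : PB α) : rep α ν ((tautological α ν).e p) = ev α ν ((generic α).e p) := by
  rw [rep, Realization.lift_e, genericMap_e]; rfl

/-- The row of the unit `e (restr 1 []) = 1` in the matrix of `x` lists the coordinates of `1 * x`.
-/
theorem eq_sum_rep {ν : ℂ} (x : O α ν) :
    x = ∑ q, rep α ν x (restr 1 []) q • (tautological α ν).e q := by
  rw [← represents_rep x, Realization.e_one, one_mul]

theorem rep_injective (ν : ℂ) : Function.Injective (rep α ν) := by
  intro x y h
  rw [eq_sum_rep x, h, ← eq_sum_rep]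

-- At integers n ≥ α this row holds the unique coordinates of `e p`, and a polynomial identity
-- follows. It yields independence of the `e p` after any base change.
open Classical in
theorem generic_e_apply (p q : PB α) :
    (generic α).e p (restr 1 []) q = if q = p then 1 else 0 := by
  refine eq_of_infinite_eval_eq _ _ (((Set.Ici_infinite α).image
    (Nat.cast_injective (R := ℂ)).injOn).mono ?_)
  rintro _ ⟨n, hn, rfl⟩
  have h := eq_sum_rep ((tautological α (n : ℂ)).e p)
  have hli := Fintype.linearIndependent_iff.1 (linearIndependent_e_of_le (α := α) hn)
    (fun q => rep α n ((tautological α (n : ℂ)).e p) (restr 1 []) q - if q = p then 1 else 0)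
  have := hli (by simp only [sub_smul, Finset.sum_sub_distrib, ← h]; simp) q
  rw [sub_eq_zero, rep_e, ev_apply] at this
  rw [Set.mem_ofPred_eq, this]
  split_ifs <;> simp

open Classical in
theorem genericMap_e_apply {k : Type*} [CommRing k] (χ : ℂ[X] →+* k) (p q : PB α) :
    (genericMap χ).e p (restr 1 []) q = if q = p then 1 else 0 := by
  rw [genericMap_e, Matrix.map_apply, generic_e_apply]
  split_ifs <;> simp

theorem sum_smul_genericMap_e_apply {k : Type*} [CommRing k] (χ : ℂ[X] →+* k) (c : PB α → k)
    (q : PB α) : (∑ p, c p • (genericMap χ).e p) (restr 1 []) q = c q := by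
  classical
  simp [Matrix.sum_apply, genericMap_e_apply]

theorem linearIndependent_genericMap_e {k : Type*} [CommRing k] (χ : ℂ[X] →+* k) :
    LinearIndependent k (genericMap (α := α) χ).e := by
  rw [Fintype.linearIndependent_iff]
  intro c hc p
  rw [← sum_smul_genericMap_e_apply χ c p, hc, Matrix.zero_apply]

theorem linearIndependent_e (ν : ℂ) : LinearIndependent ℂ (tautological α ν).e := by
  refine LinearIndependent.of_comp (rep α ν).toLinearMap ?_
  have : (rep α ν).toLinearMap ∘ (tautological α ν).e = (genericMap (evalRingHom ν)).e := by
    ext1 p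
    exact Realization.lift_e _ _ p
  rw [this]
  exact linearIndependent_genericMap_e _

theorem finrank_O (ν : ℂ) : Module.finrank ℂ (O α ν) = (partialBijections α).ncard := by
  rw [Module.finrank_eq_card_basis (Module.Basis.mk (linearIndependent_e ν) span_e.ge), card_PB]

/-- The structure constants are entries of the generic matrices, hence polynomial in the parameter.
-/
theorem generic_e_mul_e (p q : PB α) : (generic α).e p * (generic α).e q =
    ∑ s, (generic α).e q p s • (generic α).e s := by
  refine ext_of_ev fun n _ => ?_
  have h := congrArg (rep α n) (represents_rep ((tautological α (n : ℂ)).e q) p)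
  rw [map_mul, map_sum, rep_e, rep_e] at h
  rw [map_mul, h, map_sum]
  refine Finset.sum_congr rfl fun s _ => ?_
  rw [map_smul, rep_e, ev_apply]
  ext
  simp [ev_apply]

theorem genericMap_e_mul_e {k : Type*} [CommRing k] (χ : ℂ[X] →+* k) (p q : PB α) :
    (genericMap χ).e p * (genericMap χ).e q =
      ∑ s, χ ((generic α).e q p s) • (genericMap χ).e s := by
  have h := congrArg χ.mapMatrix (generic_e_mul_e p q)
  rw [map_mul, map_sum] at h
  simp only [genericMap_e]
  refine h.trans (Finset.sum_congr rfl fun s _ => ?_)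
  ext
  simp

end

/-! ### Specialization of algebraic functions of X -/

section

open Polynomial

variable {L : Type} [Field L] [Algebra ℂ[X] L]

/-- Lying over: choose a prime `Q` above the kernel of evaluation at ν. The quotient is a domain
integral over ℂ, hence equal to ℂ. -/
theorem exists_integralClosure_hom (hL : Function.Injective (algebraMap ℂ[X] L)) (ν : ℂ) :
    ∃ ψ : integralClosure ℂ[X] L →+* ℂ, ∀ p, ψ (algebraMap ℂ[X] _ p) = p.eval ν := by
  have hker : RingHom.ker (algebraMap ℂ[X] (integralClosure ℂ[X] L)) = ⊥ := by
    rw [← RingHom.injective_iff_ker_eq_bot]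
    intro x y h
    exact hL (congrArg Subtype.val h)
  have hP : (RingHom.ker (evalRingHom ν)).IsPrime := RingHom.ker_isPrime _
  obtain ⟨Q, hQ, hQP⟩ := Ideal.exists_ideal_over_prime_of_isIntegral_of_isDomain
    (S := integralClosure ℂ[X] L) (RingHom.ker (evalRingHom ν)) (hker.trans_le bot_le)
  let κ : ℂ →+* integralClosure ℂ[X] L ⧸ Q :=
    (Ideal.Quotient.mk Q).comp ((algebraMap ℂ[X] _).comp C)
  have hκ : ∀ p : ℂ[X], Ideal.Quotient.mk Q (algebraMap ℂ[X] _ p) = κ (p.eval ν) := by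
    intro p
    change _ = Ideal.Quotient.mk Q (algebraMap ℂ[X] _ (C (p.eval ν)))
    rw [Ideal.Quotient.eq, ← map_sub, ← Ideal.mem_comap, hQP, RingHom.mem_ker]
    simp
  let _ : Algebra ℂ (integralClosure ℂ[X] L ⧸ Q) := κ.toAlgebra
  have hint : Algebra.IsIntegral ℂ (integralClosure ℂ[X] L ⧸ Q) := by
    refine ⟨fun x => ?_⟩
    obtain ⟨c, rfl⟩ := Ideal.Quotient.mk_surjective x
    obtain ⟨p, hp, hpc⟩ := Algebra.IsIntegral.isIntegral (R := ℂ[X]) c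
    refine ⟨p.map (evalRingHom ν), hp.map _, ?_⟩
    have hcomp : (algebraMap ℂ (integralClosure ℂ[X] L ⧸ Q)).comp (evalRingHom ν) =
        (Ideal.Quotient.mk Q).comp (algebraMap ℂ[X] _) :=
      RingHom.ext fun p => (hκ p).symm
    rw [eval₂_map, hcomp, ← hom_eval₂, hpc, map_zero]
  have hbij : Function.Bijective κ := IsAlgClosed.algebraMap_bijective_of_isIntegral
    (k := ℂ) (K := integralClosure ℂ[X] L ⧸ Q)
  refine ⟨(RingEquiv.ofBijective κ hbij).symm.toRingHom.comp (Ideal.Quotient.mk Q), fun p => ?_⟩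
  change (RingEquiv.ofBijective κ hbij).symm (Ideal.Quotient.mk Q (algebraMap ℂ[X] _ p)) = _
  rw [RingEquiv.symm_apply_eq, hκ]
  rfl

/-- Finitely many elements of an algebraic extension of `ℂ(X)` can be specialized simultaneously
at all but finitely many values of `X`. -/
theorem exists_specialization (hL : Function.Injective (algebraMap ℂ[X] L))
    [Algebra.IsAlgebraic ℂ[X] L] (F : Set L) (hF : F.Finite) :
    ∃ f : ℂ[X], f ≠ 0 ∧ ∀ ν : ℂ, f.eval ν ≠ 0 →
      ∃ (D : Type) (_ : CommRing D) (χ : ℂ[X] →+* D) (ι : D →+* L) (ψ : D →+* ℂ),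
        Function.Injective ι ∧ ι.comp χ = algebraMap ℂ[X] L ∧ ψ.comp χ = evalRingHom ν ∧
          ∀ x ∈ F, ∃ d, ι d = x := by
  -- A common denominator `f` makes all elements of `F` integral over ℂ[X]; it is the only
  -- obstruction to specializing at ν.
  obtain ⟨f, hf, hint⟩ := Algebra.IsAlgebraic.exists_integral_multiples ℂ[X] hF.toFinset
  refine ⟨f, hf, fun ν hν => ?_⟩
  obtain ⟨ψ, hψ⟩ := exists_integralClosure_hom hL ν
  -- `D` is the integral closure localized at the elements not killed by `ψ`; it still embeds in
  -- `L`, and `f` is invertible in it.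
  let M : Submonoid (integralClosure ℂ[X] L) := (nonZeroDivisors ℂ).comap ψ
  have hM : ∀ y : M, ψ y ≠ 0 := fun y => nonZeroDivisors.ne_zero y.2
  have hMψ : ∀ y : M, IsUnit (ψ y) := fun y => (hM y).isUnit
  have hML : ∀ y : M, IsUnit ((integralClosure ℂ[X] L).val.toRingHom y) := fun y => by
    refine (?_ : (integralClosure ℂ[X] L).val.toRingHom y ≠ 0).isUnit
    intro h
    have h0 : (y : integralClosure ℂ[X] L) = 0 := Subtype.ext h
    exact hM y (by rw [h0, map_zero])
  have hfM : algebraMap ℂ[X] (integralClosure ℂ[X] L) f ∈ M := by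
    change ψ _ ∈ nonZeroDivisors ℂ
    rw [hψ]
    exact mem_nonZeroDivisors_of_ne_zero hν
  refine ⟨Localization M, inferInstance,
    (algebraMap (integralClosure ℂ[X] L) (Localization M)).comp (algebraMap ℂ[X] _),
    IsLocalization.lift hML, IsLocalization.lift hMψ, ?_, ?_, ?_, ?_⟩
  · rw [IsLocalization.lift_injective_iff]
    intro x y
    constructor
    · intro h
      obtain ⟨c, hc⟩ := (IsLocalization.eq_iff_exists M _).1 h
      have := congrArg (integralClosure ℂ[X] L).val.toRingHom hc
      rw [map_mul, map_mul] at this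
      exact (hML c).mul_left_cancel this
    · intro h
      exact congrArg _ (Subtype.ext h)
  · refine RingHom.ext fun p => ?_
    rw [RingHom.comp_apply, RingHom.comp_apply, IsLocalization.lift_eq]
    rfl
  · refine RingHom.ext fun p => ?_
    rw [RingHom.comp_apply, RingHom.comp_apply, IsLocalization.lift_eq, hψ]
    rfl
  · intro x hx
    refine ⟨IsLocalization.mk' _ (⟨f • x, hint x (hF.mem_toFinset.2 hx)⟩ : integralClosure ℂ[X] L)
      ⟨_, hfM⟩, ?_⟩
    rw [IsLocalization.lift_mk'_spec]
    exact Algebra.smul_def f x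

end

/-! ### The generic algebra is semisimple -/

section

open Polynomial

variable {α n : ℕ}

theorem rep_sum (ν : ℂ) (c : PB α → ℂ) :
    rep α ν (∑ p, c p • (tautological α ν).e p) =
      ∑ p, c p • (genericMap (evalRingHom ν)).e p := by
  rw [map_sum]
  refine Finset.sum_congr rfl fun p _ => ?_
  rw [map_smul, rep, Realization.lift_e]

theorem map_sum_genericMap {k k' : Type*} [CommRing k] [CommRing k'] (χ : ℂ[X] →+* k) (g : k →+* k')
    (c : PB α → k) : g.mapMatrix (∑ p, c p • (genericMap χ).e p) =
      ∑ p, g (c p) • (genericMap (g.comp χ)).e p := by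
  rw [map_sum]
  refine Finset.sum_congr rfl fun p _ => ?_
  rw [genericMap_e, genericMap_e]
  ext
  simp

theorem mapMatrix_injective {m k k' : Type*} [Fintype m] [DecidableEq m] [CommRing k] [CommRing k']
    {g : k →+* k'} (hg : Function.Injective g) : Function.Injective (g.mapMatrix (m := m)) :=
  Matrix.map_injective hg

theorem exists_sum_eq {ν : ℂ} (x : O α ν) :
    ∃ c : PB α → ℂ, x = ∑ p, c p • (tautological α ν).e p := ⟨_, eq_sum_rep x⟩

theorem e_mul_e (ν : ℂ) (p q : PB α) : (tautological α ν).e p * (tautological α ν).e q =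
    ∑ s, ((generic α).e q p s).eval ν • (tautological α ν).e s := by
  rw [represents_rep ((tautological α ν).e q) p, rep_e]
  rfl

section Generic

variable (α) {L : Type} [Field L] [Algebra ℂ[X] L]

variable (L) in
/-- The algebra `O[α;X]` over an extension `L` of `ℂ(X)`, as a matrix algebra. -/
def genericAlgebra : Subalgebra L (Matrix (PB α) (PB α) L) :=
  (Submodule.span L (Set.range (genericMap (α := α) (algebraMap ℂ[X] L)).e)).toSubalgebra
    (Submodule.subset_span ⟨_, Realization.e_one _⟩) (by
      intro x y hx hy
      obtain ⟨c, rfl⟩ := (Submodule.mem_span_range_iff_exists_fun L).1 hx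
      obtain ⟨d, rfl⟩ := (Submodule.mem_span_range_iff_exists_fun L).1 hy
      rw [Finset.sum_mul_sum]
      refine Submodule.sum_mem _ fun p _ => Submodule.sum_mem _ fun q _ => ?_
      rw [smul_mul_smul_comm, genericMap_e_mul_e]
      exact Submodule.smul_mem _ _ (Submodule.sum_mem _ fun s _ =>
        Submodule.smul_mem _ _ (Submodule.subset_span ⟨s, rfl⟩)))

theorem mem_genericAlgebra_iff {x : Matrix (PB α) (PB α) L} : x ∈ genericAlgebra α L ↔
    ∃ c : PB α → L, ∑ p, c p • (genericMap (algebraMap ℂ[X] L)).e p = x :=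
  Submodule.mem_span_range_iff_exists_fun L

variable (L) in
/-- The standard basis of the generic algebra. -/
def genericBasis : Module.Basis (PB α) L (genericAlgebra α L) :=
  Module.Basis.span (linearIndependent_genericMap_e (α := α) (algebraMap ℂ[X] L))

theorem coe_genericBasis (p : PB α) : (genericBasis α L p : Matrix (PB α) (PB α) L) =
    (genericMap (algebraMap ℂ[X] L)).e p :=
  congrArg Subtype.val
    (Module.Basis.span_apply (linearIndependent_genericMap_e (α := α) (algebraMap ℂ[X] L)) p)

theorem genericBasis_one : genericBasis α L (restr 1 []) = 1 :=
  Subtype.ext ((coe_genericBasis α _).trans (Realization.e_one _))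

theorem genericBasis_mul (p q : PB α) : genericBasis α L p * genericBasis α L q =
    ∑ s, algebraMap ℂ[X] L ((generic α).e q p s) • genericBasis α L s := by
  refine Subtype.ext ?_
  rw [MulMemClass.coe_mul, AddSubmonoidClass.coe_finsetSum]
  simp only [SetLike.val_smul, coe_genericBasis]
  exact genericMap_e_mul_e _ _ _

/-- The radical of a finite-dimensional algebra is nilpotent, so a nonzero `x` in it satisfies `(x *
y) ^ N = 0` for all `y` with fixed `N`. This survives specialization to an integer n ≥ α, where it
is impossible. -/
theorem isSemisimpleRing_genericAlgebra (hL : Function.Injective (algebraMap ℂ[X] L))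
    [Algebra.IsAlgebraic ℂ[X] L] : IsSemisimpleRing (genericAlgebra α L) := by
  have hfin : Module.Finite L (genericAlgebra α L) := Module.Finite.of_basis (genericBasis α L)
  have hart : IsArtinianRing (genericAlgebra α L) := IsArtinianRing.of_finite L _
  rw [IsArtinianRing.isSemisimpleRing_iff_jacobson, eq_bot_iff]
  intro x hx
  obtain ⟨N, hN⟩ := IsSemiprimaryRing.isNilpotent (R := genericAlgebra α L)
  have hnil : ∀ y : genericAlgebra α L, (x * y) ^ N = 0 := fun y => by
    have := Ideal.pow_mem_pow (Ideal.mul_mem_right y _ hx) N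
    rwa [hN] at this
  by_contra hx0
  obtain ⟨c, hc⟩ := (mem_genericAlgebra_iff α).1 x.2
  obtain ⟨p₀, hp₀⟩ : ∃ p, c p ≠ 0 := by
    by_contra h
    push Not at h
    refine hx0 (Subtype.ext ?_)
    rw [← hc]
    exact Finset.sum_eq_zero fun p _ => by rw [h, zero_smul]
  -- Including the inverse of a nonzero coefficient makes that coefficient a unit in `D`, so its
  -- specialization is nonzero.
  obtain ⟨f, hf, hspec⟩ := exists_specialization hL (insert (c p₀)⁻¹ (Set.range c))
    ((Set.finite_range c).insert _)
  obtain ⟨n, hn, hfn⟩ : ∃ n : ℕ, α ≤ n ∧ f.eval (n : ℂ) ≠ 0 := by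
    by_contra h
    push Not at h
    refine hf (eq_of_infinite_eval_eq _ _ (((Set.Ici_infinite α).image
      (Nat.cast_injective (R := ℂ)).injOn).mono ?_))
    rintro _ ⟨n, hn, rfl⟩
    simpa using h n hn
  obtain ⟨D, _, χ, ι, ψ, hι, hιχ, hψχ, hF⟩ := hspec n hfn
  choose d hd using fun p => hF (c p) (Or.inr ⟨p, rfl⟩)
  obtain ⟨d', hd'⟩ := hF _ (Or.inl rfl)
  have hψd : ψ (d p₀) ≠ 0 := by
    have h1 : d p₀ * d' = 1 := hι (by rw [map_mul, hd, hd', map_one, mul_inv_cancel₀ hp₀])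
    intro h0
    have := congrArg ψ h1
    rw [map_mul, h0, zero_mul, map_one] at this
    exact zero_ne_one this
  have hx0 : (∑ p, ψ (d p) • (tautological α (n : ℂ)).e p) = 0 := by
    refine eq_zero_of_forall_pow_eq_zero hn N fun y => ?_
    obtain ⟨u, rfl⟩ := exists_sum_eq y
    have h1 : ((∑ p, d p • (genericMap χ).e p) *
        (∑ p, χ (C (u p)) • (genericMap χ).e p)) ^ N = 0 := by
      refine mapMatrix_injective hι ?_
      rw [map_pow, map_mul, map_sum_genericMap, map_sum_genericMap, hιχ, map_zero]
      simp only [hd, hc]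
      exact congrArg Subtype.val (hnil ⟨_, (mem_genericAlgebra_iff α).2 ⟨_, rfl⟩⟩)
    have h2 := congrArg ψ.mapMatrix h1
    rw [map_pow, map_mul, map_sum_genericMap, map_sum_genericMap, hψχ, map_zero] at h2
    refine rep_injective _ ?_
    rw [map_pow, map_mul, rep_sum, rep_sum, map_zero, ← h2]
    have hu : ∀ p, ψ (χ (C (u p))) = u p := fun p => by
      rw [← RingHom.comp_apply, hψχ]; simp
    simp only [hu]
  have := Fintype.linearIndependent_iff.1 (linearIndependent_e (α := α) (n : ℂ)) _ hx0 p₀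
  exact hψd this

end Generic

/-! ### Products of matrix algebras and descent of the decomposition to ℂ -/

section Blocks

variable {m : ℕ} {d : Fin m → ℕ}

/-- A ring homomorphism applied to all entries of a tuple of matrices. -/
def mapBlocks {k k' : Type*} [CommRing k] [CommRing k'] (g : k →+* k') :
    (∀ i : Fin m, Matrix (Fin (d i)) (Fin (d i)) k) →+*
      (∀ i : Fin m, Matrix (Fin (d i)) (Fin (d i)) k') :=
  RingHom.pi fun i => g.mapMatrix.comp (Pi.evalRingHom _ i)

variable {k k' : Type*} [CommRing k] [CommRing k'] (g : k →+* k')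

theorem mapBlocks_apply (x : ∀ i : Fin m, Matrix (Fin (d i)) (Fin (d i)) k) (i : Fin m)
    (a b : Fin (d i)) : mapBlocks g x i a b = g (x i a b) := rfl

theorem mapBlocks_smul (c : k) (x : ∀ i : Fin m, Matrix (Fin (d i)) (Fin (d i)) k) :
    mapBlocks g (c • x) = g c • mapBlocks g x := by
  ext i a b
  simp [mapBlocks_apply]

theorem mapBlocks_injective {g : k →+* k'} (hg : Function.Injective g) :
    Function.Injective (mapBlocks (d := d) g) := by
  intro x y h
  ext i a b
  exact hg (congrFun (congrFun (congrFun h i) a) b)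

variable (k) in
/-- A matrix unit in a product of matrix algebras. -/
def blockUnit (i : Fin m) (a b : Fin (d i)) : ∀ i : Fin m, Matrix (Fin (d i)) (Fin (d i)) k :=
  Pi.single i (Matrix.single a b 1)

theorem mapBlocks_blockUnit (i : Fin m) (a b : Fin (d i)) :
    mapBlocks g (blockUnit k i a b) = blockUnit k' i a b := by
  ext j u v
  rw [mapBlocks_apply, blockUnit, blockUnit]
  by_cases h : j = i
  · subst h
    simp only [Pi.single_eq_same, Matrix.single_apply]
    split_ifs <;> simp
  · simp [Pi.single_eq_of_ne h]

theorem eq_sum_blockUnit (x : ∀ i : Fin m, Matrix (Fin (d i)) (Fin (d i)) k) :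
    x = ∑ i, ∑ a, ∑ b, x i a b • blockUnit k i a b := by
  have h : ∀ i, ∑ a, ∑ b, x i a b • blockUnit k i a b = Pi.single i (x i) := by
    intro i
    conv_rhs => rw [Matrix.matrix_eq_sum_single (x i)]
    ext j u v
    by_cases h : j = i
    · subst h
      simp [blockUnit, Matrix.sum_apply, Finset.sum_apply, Matrix.single_apply]
    · simp [blockUnit, Pi.single_eq_of_ne h, Matrix.sum_apply]
  rw [Finset.sum_congr rfl fun i _ => h i, Finset.univ_sum_single]

theorem finrank_blocks (F : Type*) [Field F] :
    Module.finrank F (∀ i : Fin m, Matrix (Fin (d i)) (Fin (d i)) F) = ∑ i, d i * d i := by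
  simp [Module.finrank_pi_fintype, Module.finrank_matrix]

end Blocks

/-- The Wedderburn decomposition over `L` has a finite table: the entries of the images `w p` of the
basis, and the coordinates `Q` of the preimages of the matrix units. Identities among them descend
to `D` by injectivity and pass to ℂ by `ψ`. The sizes `d` come from `L`, hence do not depend on ν.
-/
theorem exists_blocks (α : ℕ) : ∃ (m : ℕ) (d : Fin m → ℕ), (∀ i, 0 < d i) ∧
    ∃ f : ℂ[X], f ≠ 0 ∧ ∀ ν : ℂ, f.eval ν ≠ 0 →
      Nonempty (O α ν ≃ₐ[ℂ] (∀ i : Fin m, Matrix (Fin (d i)) (Fin (d i)) ℂ)) := by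
  let L := AlgebraicClosure (FractionRing ℂ[X])
  have hL : Function.Injective (algebraMap ℂ[X] L) := by
    rw [IsScalarTower.algebraMap_eq ℂ[X] (FractionRing ℂ[X]) L]
    exact (algebraMap (FractionRing ℂ[X]) L).injective.comp (IsFractionRing.injective _ _)
  have h1 : Algebra.IsAlgebraic ℂ[X] (FractionRing ℂ[X]) :=
    IsLocalization.isAlgebraic _ (nonZeroDivisors ℂ[X])
  have hAlg : Algebra.IsAlgebraic ℂ[X] L := Algebra.IsAlgebraic.trans ℂ[X] (FractionRing ℂ[X]) L
  have hss := isSemisimpleRing_genericAlgebra α hL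
  have hfin : Module.Finite L (genericAlgebra α L) := Module.Finite.of_basis (genericBasis α L)
  obtain ⟨m, d, hd, ⟨Φ⟩⟩ :=
    IsSemisimpleRing.exists_algEquiv_pi_matrix_of_isAlgClosed L (genericAlgebra α L)
  let w : PB α → ∀ i : Fin m, Matrix (Fin (d i)) (Fin (d i)) L := fun p => Φ (genericBasis α L p)
  let Q : (Σ i : Fin m, Fin (d i) × Fin (d i)) → PB α → L := fun t p =>
    (genericBasis α L).repr (Φ.symm (blockUnit L t.1 t.2.1 t.2.2)) p
  have hQ : ∀ t, ∑ p, Q t p • w p = blockUnit L t.1 t.2.1 t.2.2 := fun t => by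
    have := congrArg Φ ((genericBasis α L).sum_repr (Φ.symm (blockUnit L t.1 t.2.1 t.2.2)))
    rw [map_sum, AlgEquiv.apply_symm_apply] at this
    rw [← this]
    exact Finset.sum_congr rfl fun p _ => (map_smul Φ _ _).symm
  have hw1 : w (restr 1 []) = 1 := by
    change Φ _ = 1
    rw [genericBasis_one, map_one]
  have hwmul : ∀ p q, w p * w q = ∑ s, algebraMap ℂ[X] L ((generic α).e q p s) • w s := by
    intro p q
    change Φ _ * Φ _ = _
    rw [← map_mul, genericBasis_mul, map_sum]
    exact Finset.sum_congr rfl fun s _ => map_smul Φ _ _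
  obtain ⟨f, hf, hspec⟩ := exists_specialization hL
    (Set.range (fun t : PB α × (Σ i : Fin m, Fin (d i) × Fin (d i)) => w t.1 t.2.1 t.2.2.1 t.2.2.2) ∪
      Set.range (fun t : (Σ i : Fin m, Fin (d i) × Fin (d i)) × PB α => Q t.1 t.2))
    ((Set.finite_range _).union (Set.finite_range _))
  refine ⟨m, d, fun i => Nat.pos_of_ne_zero (hd i).out, f, hf, fun ν hν => ?_⟩
  obtain ⟨D, _, χ, ι, ψ, hι, hιχ, hψχ, hF⟩ := hspec ν hν
  choose QD hQD using fun t p => hF (Q t p) (Or.inr ⟨(t, p), rfl⟩)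
  obtain ⟨wD, hwD'⟩ : ∃ wD : PB α → ∀ i : Fin m, Matrix (Fin (d i)) (Fin (d i)) D,
      ∀ p, mapBlocks ι (wD p) = w p := by
    choose u hu using fun p i a b => hF (w p i a b) (Or.inl ⟨(p, ⟨i, a, b⟩), rfl⟩)
    refine ⟨fun p i => Matrix.of (u p i), fun p => ?_⟩
    ext i a b
    exact hu p i a b
  have hι' := mapBlocks_injective (d := d) hι
  have hwD1 : wD (restr 1 []) = 1 := hι' (by rw [hwD', hw1, map_one])
  have hwDmul : ∀ p q, wD p * wD q = ∑ s, χ ((generic α).e q p s) • wD s := fun p q => hι' (by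
    rw [map_mul, hwD', hwD', hwmul, map_sum, ← hιχ]
    refine Finset.sum_congr rfl fun s _ => ?_
    rw [mapBlocks_smul, hwD']
    rfl)
  have hQD' : ∀ t, ∑ p, QD t p • wD p = blockUnit D t.1 t.2.1 t.2.2 := fun t => hι' (by
    rw [mapBlocks_blockUnit, ← hQ, map_sum]
    refine Finset.sum_congr rfl fun p _ => ?_
    rw [mapBlocks_smul, hwD', hQD])
  let b := Module.Basis.mk (linearIndependent_e (α := α) ν) span_e.ge
  have hb : ∀ p, b p = (tautological α ν).e p := fun p => Module.Basis.mk_apply _ _ p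
  let F : O α ν →ₗ[ℂ] (∀ i : Fin m, Matrix (Fin (d i)) (Fin (d i)) ℂ) :=
    b.constr ℂ fun p => mapBlocks ψ (wD p)
  have hFe : ∀ p, F ((tautological α ν).e p) = mapBlocks ψ (wD p) := fun p => by
    rw [← hb]; exact b.constr_basis ℂ _ p
  have hF1 : F 1 = 1 := by
    rw [← Realization.e_one (tautological α ν), hFe, hwD1, map_one]
  have hFmul : ∀ x y, F (x * y) = F x * F y := by
    have he : ∀ p q, F ((tautological α ν).e p * (tautological α ν).e q) =
        F ((tautological α ν).e p) * F ((tautological α ν).e q) := fun p q => by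
      rw [e_mul_e, map_sum, hFe, hFe, ← map_mul, hwDmul, map_sum]
      refine Finset.sum_congr rfl fun s _ => ?_
      rw [map_smul, hFe, mapBlocks_smul, ← RingHom.comp_apply, hψχ]
      rfl
    intro x y
    obtain ⟨c, rfl⟩ := exists_sum_eq x
    obtain ⟨c', rfl⟩ := exists_sum_eq y
    simp only [Finset.sum_mul_sum, map_sum, smul_mul_smul_comm, map_smul, he]
  -- The specialized coordinates `ψ (QD t p)` give preimages of all matrix units.
  have hFsurj : Function.Surjective F := by
    have hu : ∀ i a b, ∃ x, F x = blockUnit ℂ i a b := fun i a b => by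
      refine ⟨∑ p, ψ (QD ⟨i, a, b⟩ p) • (tautological α ν).e p, ?_⟩
      have := congrArg (mapBlocks ψ) (hQD' ⟨i, a, b⟩)
      rw [mapBlocks_blockUnit, map_sum] at this
      rw [← this, map_sum]
      refine Finset.sum_congr rfl fun p _ => ?_
      rw [map_smul, hFe, mapBlocks_smul]
    choose u hu using hu
    intro x
    refine ⟨∑ i, ∑ a, ∑ b, x i a b • u i a b, ?_⟩
    simp only [map_sum, map_smul, hu]
    exact (eq_sum_blockUnit x).symm
  -- Both dimensions equal the number of partial bijections, the second through the decomposition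
  -- over `L`; surjectivity thus implies bijectivity.
  have hrank : Module.finrank ℂ (O α ν) =
      Module.finrank ℂ (∀ i : Fin m, Matrix (Fin (d i)) (Fin (d i)) ℂ) := by
    rw [finrank_blocks, ← finrank_blocks L, ← Φ.toLinearEquiv.finrank_eq,
      Module.finrank_eq_card_basis (genericBasis α L), Module.finrank_eq_card_basis b]
  have hFinj := (LinearMap.injective_iff_surjective_of_finrank_eq_finrank hrank).2 hFsurj
  exact ⟨AlgEquiv.ofBijective (AlgHom.ofLinearMap F hF1 hFmul) ⟨hFinj, hFsurj⟩⟩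

end

end DoubleCosetAlgebra
end

theorem theorem2p3 (α : ℕ) :
    -- (a) the dimension
    (∀ ν : ℂ, Module.Finite ℂ (DoubleCosetAlgebra.O α ν) ∧
      Module.finrank ℂ (DoubleCosetAlgebra.O α ν) =
        (DoubleCosetAlgebra.partialBijections α).ncard) ∧
    -- (b) the homomorphism
    (∀ n : ℕ, ∃! φ : DoubleCosetAlgebra.O α (n : ℂ) →ₙₐ[ℂ] DoubleCosetAlgebra.DC α n,
      DoubleCosetAlgebra.IsCanonical φ) ∧
    -- (c) bijectivity and surjectivity
    (∀ (n : ℕ) (φ : DoubleCosetAlgebra.O α (n : ℂ) →ₙₐ[ℂ] DoubleCosetAlgebra.DC α n),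
      DoubleCosetAlgebra.IsCanonical φ →
        (α ≤ n → Function.Bijective φ) ∧ (n < α → Function.Surjective φ)) ∧
    -- (d) all but finitely many of the algebras are isomorphic sums of matrix algebras
    (∃ E : Set ℂ, E.Finite ∧
      (∀ ν ∉ E, ∀ μ ∉ E,
        Nonempty (DoubleCosetAlgebra.O α ν ≃ₐ[ℂ] DoubleCosetAlgebra.O α μ)) ∧
      ∀ ν ∉ E, ∃ (k : ℕ) (d : Fin k → ℕ), (∀ i, 0 < d i) ∧
        Nonempty (DoubleCosetAlgebra.O α ν ≃ₐ[ℂ]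
          (∀ i : Fin k, Matrix (Fin (d i)) (Fin (d i)) ℂ))) := by
  refine ⟨fun ν => ⟨inferInstance, DoubleCosetAlgebra.finrank_O ν⟩,
    fun n => ⟨_, DoubleCosetAlgebra.isCanonical_canonical,
      fun φ hφ => hφ.eq DoubleCosetAlgebra.isCanonical_canonical⟩, fun n φ hφ => ?_, ?_⟩
  · rw [hφ.eq DoubleCosetAlgebra.isCanonical_canonical]
    exact ⟨fun hn => ⟨DoubleCosetAlgebra.canonical_injective hn,
      DoubleCosetAlgebra.canonical_surjective⟩, fun _ => DoubleCosetAlgebra.canonical_surjective⟩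
  · obtain ⟨m, d, hd, f, hf, h⟩ := DoubleCosetAlgebra.exists_blocks α
    -- The exceptional set is the zero set of the common denominator.
    refine ⟨{ν | f.eval ν = 0}, (f.finite_setOfPred_isRoot hf), fun ν hν μ hμ => ?_,
      fun ν hν => ⟨m, d, hd, h ν hν⟩⟩
    obtain ⟨e₁⟩ := h ν hν
    obtain ⟨e₂⟩ := h μ hμ
    exact ⟨e₁.trans e₂.symm⟩
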